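/- Let $N\ge 1$, let $B$ be the open unit ball of $\mathbb R^N$, and fix $p\in(1,2)$. Let $\mathcal C$ be the cone of all radial functions $u\in W^{1,p}(B)$ that are nonnegative and radially non-decreasing, i.e. $u\ge 0$ and $u(r_1)\le u(r_2)$ whenever $0<r_1\le r_2\le 1$, where $u(|x|):=u(x)$. For $q>p$ consider the Neumann problem $$-\Delta_p u+u^{p-1}=u^{q-1}\ \text{ in } B,\qquad u>0\ \text{ in } B,\qquad \partial_\nu u=0\ \text{ on }\partial B; \tag{$P_q$}$$ a function $u\in\mathcal C$, $u>0$ a.e. in $B$, is a (weak) solution of $(P_q)$ if $$\int_B|\nabla u|^{p-2}\nabla u\cdot\nabla\varphi\,dx+\int_B u^{p-1}\varphi\,dx=\int_B u^{q-1}\varphi\,dx\qquad\text{for all }\varphi\in W^{1,p}(B).$$ Let $S\subset(p,\infty)$ be a set of exponents (for instance $S=(q_0,\infty)$) and, for every $q\in S$, let $v_q\in\mathcal C$ be a solution of $(P_q)$ whose energy is higher than that of the constant $1$, namely $$\int_B\left(\frac{|\nabla v_q|^p}{p}+\frac{|v_q|^p}{p}-\frac{|v_q|^q}{q}\right)dx>|B|\left(\frac1p-\frac1q\right).$$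 Then every $v_q$ has a representative that is continuous on $\bar B$ and, for these representatives, as $q\to\infty$ with $q\in S$, $$v_q\to 1\quad\text{in } W^{1,p}(B)\ \text{ and in } C^{0,\nu}(\bar B)\ \text{ for every }\nu\in(0,1).$$ -/

import Mathlib

open Set Filter Topology MeasureTheory
open scoped NNReal ENNReal ContDiff

noncomputable section

/-- `G` is the weak (distributional) gradient of `u` on the open set `Ω ⊆ ℝᴺ`: both are locally
integrable on `Ω` and `∫_Ω u ∂ᵢφ = -∫_Ω Gᵢ φ` for all `φ ∈ C_c^∞(Ω)` and all `i`. -/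
def IsWeakGradient {N : ℕ} (Ω : Set (EuclideanSpace ℝ (Fin N)))
    (u : EuclideanSpace ℝ (Fin N) → ℝ)
    (G : EuclideanSpace ℝ (Fin N) → EuclideanSpace ℝ (Fin N)) : Prop :=
  LocallyIntegrableOn u Ω ∧ LocallyIntegrableOn G Ω ∧
    ∀ φ : EuclideanSpace ℝ (Fin N) → ℝ, ContDiff ℝ ∞ φ → HasCompactSupport φ → tsupport φ ⊆ Ω →
      ∀ i : Fin N, ∫ x in Ω, u x * fderiv ℝ φ x (EuclideanSpace.single i 1)
        = -∫ x in Ω, G x i * φ x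

open Classical in
/-- The weak gradient of `u` on `Ω`. It is determined almost everywhere on `Ω` when it exists
(and is set to `0` for functions that have none). -/
def weakGrad {N : ℕ} (Ω : Set (EuclideanSpace ℝ (Fin N))) (u : EuclideanSpace ℝ (Fin N) → ℝ) :
    EuclideanSpace ℝ (Fin N) → EuclideanSpace ℝ (Fin N) :=
  if h : ∃ G, IsWeakGradient Ω u G then h.choose else 0

/-- `u` belongs to the Sobolev space `W^{1,p}(Ω)`. -/
def MemSobolev {N : ℕ} (p : ℝ) (Ω : Set (EuclideanSpace ℝ (Fin N)))
    (u : EuclideanSpace ℝ (Fin N) → ℝ) : Prop :=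
  MemLp u (ENNReal.ofReal p) (volume.restrict Ω) ∧
    ∃ G, IsWeakGradient Ω u G ∧ MemLp G (ENNReal.ofReal p) (volume.restrict Ω)

/-- The norm `(∫_Ω |∇u|^p + |u|^p dx)^{1/p}` of `u ∈ W^{1,p}(Ω)`, with values in `[0,∞]`. -/
def sobolevNorm {N : ℕ} (p : ℝ) (Ω : Set (EuclideanSpace ℝ (Fin N)))
    (u : EuclideanSpace ℝ (Fin N) → ℝ) : ℝ≥0∞ :=
  (∫⁻ x in Ω, (‖weakGrad Ω u x‖ₑ ^ p + ‖u x‖ₑ ^ p)) ^ (1 / p)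

/-- The norm of `C^{0,ν}(K)`, with values in `[0,∞]`: the supremum of `|u|` on `K` plus the
`ν`-Hölder seminorm of `u` on `K`. -/
def holderNormOn {N : ℕ} (ν : ℝ≥0) (K : Set (EuclideanSpace ℝ (Fin N)))
    (u : EuclideanSpace ℝ (Fin N) → ℝ) : ℝ≥0∞ :=
  (⨆ x ∈ K, ‖u x‖ₑ) + eHolderNorm ν (K.domRestrict u)

/-- The open unit ball `B` of `ℝᴺ`. -/
abbrev unitBall (N : ℕ) : Set (EuclideanSpace ℝ (Fin N)) := Metric.ball 0 1

/-- The cone `𝒞` of the (classes of) nonnegative, radial, radially non-decreasing functions in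
`W^{1,p}(B)`: `u(x) = g(|x|)` for almost every `x ∈ B`, where the profile `g` is nonnegative and
non-decreasing on `(0,1]`. -/
def MemCone {N : ℕ} (p : ℝ) (u : EuclideanSpace ℝ (Fin N) → ℝ) : Prop :=
  MemSobolev p (unitBall N) u ∧
    ∃ g : ℝ → ℝ, (∀ r ∈ Ioc (0 : ℝ) 1, 0 ≤ g r) ∧ MonotoneOn g (Ioc 0 1) ∧
      ∀ᵐ x ∂(volume.restrict (unitBall N)), u x = g ‖x‖

/-- `u ∈ 𝒞` is a (weak) solution of `-Δ_p u + u^{p-1} = u^{q-1}` in `B`, `u > 0` in `B`,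
`∂_ν u = 0` on `∂B`. Every term below is integrable, since functions in `𝒞` are bounded. The
Neumann condition is encoded by testing with all of `W^{1,p}(B)`. -/
def IsConeSolution {N : ℕ} (p q : ℝ) (u : EuclideanSpace ℝ (Fin N) → ℝ) : Prop :=
  MemCone p u ∧ (∀ᵐ x ∂(volume.restrict (unitBall N)), 0 < u x) ∧
    ∀ φ : EuclideanSpace ℝ (Fin N) → ℝ, MemSobolev p (unitBall N) φ →
      (∫ x in unitBall N, ‖weakGrad (unitBall N) u x‖ ^ (p - 2) *
          inner ℝ (weakGrad (unitBall N) u x) (weakGrad (unitBall N) φ x))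
        + (∫ x in unitBall N, u x ^ (p - 1) * φ x)
        = ∫ x in unitBall N, u x ^ (q - 1) * φ x

/-- The energy `∫_B |∇u|^p / p + |u|^p / p - |u|^q / q dx`. -/
def energy {N : ℕ} (p q : ℝ) (u : EuclideanSpace ℝ (Fin N) → ℝ) : ℝ :=
  ∫ x in unitBall N,
    (‖weakGrad (unitBall N) u x‖ ^ p / p + |u x| ^ p / p - |u x| ^ q / q)

end

/-! The proof reduces to an ODE for a radial profile. Write `n = N - 1` and `k = u^{p-1} - u^{q-1}`.
Testing with the constant `1` shows that `k` has mean zero. Since `u` is radially non-decreasing,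
`k` changes sign at most once, from plus to minus, so `H(r) = ∫_0^r s^n k ds` is nonnegative on
`[0,1]`. Let `W' = ρ = (H/r^n)^{1/(p-1)}`. The flux of `W(|x|)` is a radial field with divergence
`k` and no flux through the boundary, so it satisfies the same weak equation as the flux of `u`.
Testing with `u - W` and using strict monotonicity of the p-Laplacian flux gives `∇u = ∇W`, hence `u
= U(|x|)` with `U = W + const` of class `C^1` (`IsConeSolution.exists_contDiff_profile`).

For the ODE the quantity `(p-1)/p ρ^p + U^q/q - U^p/p` decreases along the radius
(`antitoneOn_hamiltonian`). At `r = 0` it is nonpositive, because `ρ(0) = 0` and mean zero forces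
`U(0) ≤ 1`. Hence `U ≤ M_q = (q/p)^{1/(q-p)}`, which tends to `1`, and `ρ ≤ (p-1)^{-1/p} U`, a
Lipschitz bound uniform for large `q` (`profile_bounds`).

By the Nehari identity the energy is `(1/p - 1/q) ∫u^q`, so the hypothesis says `∫u^q > |B|`. Since
`∫u^q ≤ M_q ∫u^{q-1} = M_q ∫u^{p-1}`, it follows that `∫u^{p-1} ≥ |B|/M_q`: the profile lies below
`M_q` but is nearly `1` in mean. With the Lipschitz bound this forces its minimum `U(0)` to tend to
`1` (`tendsto_profile_zero`). Now `M_q - U(0)` tends to `0` and controls everything: the sup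
distance to `1` directly, the Hölder seminorm by interpolation with the Lipschitz bound, and the
gradient through `∫|∇u|^p = ∫u^q - ∫u^p ≤ |B|(M_q^p - U(0)^p)`. -/

/-! ### Calculus of weak gradients. -/

section WeakGradient

variable {N : ℕ} {Ω : Set (EuclideanSpace ℝ (Fin N))}
  {u v : EuclideanSpace ℝ (Fin N) → ℝ} {F G : EuclideanSpace ℝ (Fin N) → EuclideanSpace ℝ (Fin N)}

theorem MeasureTheory.IntegrableOn.mul_of_hasCompactSupport {f φ : EuclideanSpace ℝ (Fin N) → ℝ}
    (hφ : Continuous φ) (hφc : HasCompactSupport φ) {s : Set (EuclideanSpace ℝ (Fin N))}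
    (hf : IntegrableOn f s) (hs : tsupport φ ⊆ s) : Integrable (fun x => f x * φ x) := by
  have h1 : IntegrableOn (fun x => f x * φ x) (tsupport φ) :=
    (hf.mono_set hs).mul_continuousOn hφ.continuousOn hφc
  refine (integrableOn_iff_integrable_of_support_subset ?_).1 h1
  intro x hx
  apply subset_tsupport
  simp only [Function.mem_support, ne_eq, mul_eq_zero, not_or] at hx ⊢
  exact hx.2

theorem MeasureTheory.LocallyIntegrableOn.mul_of_hasCompactSupport {f φ : EuclideanSpace ℝ (Fin N) → ℝ}
    (hφ : Continuous φ) (hφc : HasCompactSupport φ)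
    (hf : LocallyIntegrableOn f Ω) (hs : tsupport φ ⊆ Ω) : Integrable (fun x => f x * φ x) :=
  IntegrableOn.mul_of_hasCompactSupport hφ hφc (hf.integrableOn_compact_subset hs hφc) le_rfl

theorem MeasureTheory.LocallyIntegrableOn.euclidean_apply (hG : LocallyIntegrableOn G Ω) (i : Fin N) :
    LocallyIntegrableOn (fun x => G x i) Ω := by
  intro x hx
  obtain ⟨s, hs, hsi⟩ := hG x hx
  exact ⟨s, hs, (EuclideanSpace.proj (𝕜 := ℝ) i).integrable_comp hsi⟩

theorem continuous_fderiv_single {φ : EuclideanSpace ℝ (Fin N) → ℝ} (hφ : ContDiff ℝ ∞ φ)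
    (i : Fin N) : Continuous fun x => fderiv ℝ φ x (EuclideanSpace.single i 1) :=
  (hφ.continuous_fderiv (by simp)).clm_apply continuous_const

theorem hasCompactSupport_fderiv_single {φ : EuclideanSpace ℝ (Fin N) → ℝ}
    (hφ : HasCompactSupport φ) (i : Fin N) :
    HasCompactSupport fun x => fderiv ℝ φ x (EuclideanSpace.single i 1) :=
  hφ.fderiv_apply ℝ _

theorem tsupport_fderiv_single_subset (φ : EuclideanSpace ℝ (Fin N) → ℝ) (i : Fin N) :
    tsupport (fun x => fderiv ℝ φ x (EuclideanSpace.single i 1)) ⊆ tsupport φ :=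
  tsupport_fderiv_apply_subset ℝ _

theorem IsWeakGradient.ae_eq (hΩ : IsOpen Ω) (hF : IsWeakGradient Ω u F)
    (hG : IsWeakGradient Ω u G) : F =ᵐ[volume.restrict Ω] G := by
  have key : ∀ i : Fin N, ∀ᵐ x ∂volume, x ∈ Ω → F x i - G x i = 0 := by
    intro i
    refine hΩ.ae_eq_zero_of_integral_contDiff_smul_eq_zero
      ((hF.2.1.euclidean_apply i).sub (hG.2.1.euclidean_apply i)) ?_
    intro φ h1 h2 h3
    have hf := hF.2.2 φ h1 h2 h3 i
    have hg := hG.2.2 φ h1 h2 h3 i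
    have e1 := LocallyIntegrableOn.mul_of_hasCompactSupport h1.continuous h2
      (hF.2.1.euclidean_apply i) h3
    have e2 := LocallyIntegrableOn.mul_of_hasCompactSupport h1.continuous h2
      (hG.2.1.euclidean_apply i) h3
    have e3 : ∀ H : EuclideanSpace ℝ (Fin N) → ℝ,
        ∫ x in Ω, H x * φ x = ∫ x, H x * φ x := by
      intro H
      refine setIntegral_eq_integral_of_forall_compl_eq_zero fun x hx => ?_
      rw [image_eq_zero_of_notMem_tsupport (fun h => hx (h3 h)), mul_zero]
    calc ∫ x, φ x • (F x i - G x i) = ∫ x, (F x i * φ x - G x i * φ x) := by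
          congr 1; ext x; simp only [smul_eq_mul]; ring
      _ = 0 := by
          rw [integral_sub e1 e2, ← e3, ← e3]
          linarith
  have := ae_all_iff.2 key
  filter_upwards [ae_restrict_of_ae this, ae_restrict_mem hΩ.measurableSet] with x hx hxΩ
  ext i
  linarith [hx i hxΩ]

/-- `weakGrad` is an arbitrary choice; this lets any explicit weak gradient replace it under an
integral. -/
theorem IsWeakGradient.weakGrad_ae_eq (hΩ : IsOpen Ω) (hG : IsWeakGradient Ω u G) :
    weakGrad Ω u =ᵐ[volume.restrict Ω] G := by
  have h : ∃ G, IsWeakGradient Ω u G := ⟨G, hG⟩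
  rw [weakGrad, dif_pos h]
  exact h.choose_spec.ae_eq hΩ hG

theorem MemSobolev.isWeakGradient {p : ℝ} (hu : MemSobolev p Ω u) :
    IsWeakGradient Ω u (weakGrad Ω u) := by
  have h : ∃ G, IsWeakGradient Ω u G := ⟨_, hu.2.choose_spec.1⟩
  rw [weakGrad, dif_pos h]
  exact h.choose_spec

theorem MemSobolev.memLp_weakGrad {p : ℝ} (hΩ : IsOpen Ω) (hu : MemSobolev p Ω u) :
    MemLp (weakGrad Ω u) (ENNReal.ofReal p) (volume.restrict Ω) := by
  obtain ⟨G, hG, hGp⟩ := hu.2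
  exact hGp.ae_eq (hG.weakGrad_ae_eq hΩ).symm

theorem MeasureTheory.LocallyIntegrableOn.congr_ae_restrict {E F : Type*} [MeasurableSpace E]
    [TopologicalSpace E] [OpensMeasurableSpace E] [NormedAddCommGroup F] {μ : Measure E}
    {f g : E → F} {U : Set E} (hf : LocallyIntegrableOn f U μ)
    (h : f =ᵐ[μ.restrict U] g) : LocallyIntegrableOn g U μ := by
  intro x hx
  obtain ⟨s, hs, hsi⟩ := hf x hx
  refine ⟨s ∩ U, inter_mem hs self_mem_nhdsWithin, ?_⟩
  exact (hsi.mono_set inter_subset_left).congr_fun_ae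
    (ae_restrict_of_ae_restrict_of_subset inter_subset_right h)

theorem IsWeakGradient.congr (hG : IsWeakGradient Ω u G)
    (huv : u =ᵐ[volume.restrict Ω] v) : IsWeakGradient Ω v G := by
  refine ⟨hG.1.congr_ae_restrict huv, hG.2.1, fun φ h1 h2 h3 i => ?_⟩
  rw [← hG.2.2 φ h1 h2 h3 i]
  refine integral_congr_ae ?_
  filter_upwards [huv] with x hx
  rw [hx]

theorem IsWeakGradient.sub (hu : IsWeakGradient Ω u F) (hv : IsWeakGradient Ω v G) :
    IsWeakGradient Ω (fun x => u x - v x) (fun x => F x - G x) := by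
  refine ⟨hu.1.sub hv.1, hu.2.1.sub hv.2.1, fun φ h1 h2 h3 i => ?_⟩
  have eu := hu.2.2 φ h1 h2 h3 i
  have ev := hv.2.2 φ h1 h2 h3 i
  have c1 := continuous_fderiv_single h1 i
  have c2 := hasCompactSupport_fderiv_single h2 i
  have c3 := (tsupport_fderiv_single_subset φ i).trans h3
  have i1 := (LocallyIntegrableOn.mul_of_hasCompactSupport c1 c2 hu.1 c3).restrict (s := Ω)
  have i2 := (LocallyIntegrableOn.mul_of_hasCompactSupport c1 c2 hv.1 c3).restrict (s := Ω)
  have i3 := (LocallyIntegrableOn.mul_of_hasCompactSupport h1.continuous h2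
    (hu.2.1.euclidean_apply i) h3).restrict (s := Ω)
  have i4 := (LocallyIntegrableOn.mul_of_hasCompactSupport h1.continuous h2
    (hv.2.1.euclidean_apply i) h3).restrict (s := Ω)
  simp only [sub_mul, PiLp.sub_apply]
  rw [integral_sub i1 i2, integral_sub i3 i4, eu, ev]
  ring

theorem isWeakGradient_of_hasFDerivAt (hΩ : IsOpen Ω) (hGc : ContinuousOn G Ω)
    (hG : ∀ x ∈ Ω, HasFDerivAt u (innerSL ℝ (G x)) x) : IsWeakGradient Ω u G := by
  have huc : ContinuousOn u Ω := fun x hx => (hG x hx).continuousAt.continuousWithinAt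
  have hul : LocallyIntegrableOn u Ω := huc.locallyIntegrableOn hΩ.measurableSet
  have hGl : LocallyIntegrableOn G Ω := hGc.locallyIntegrableOn hΩ.measurableSet
  refine ⟨hul, hGl, fun φ h1 h2 h3 i => ?_⟩
  have e : ∀ x ∈ Ω, fderiv ℝ u x (EuclideanSpace.single i 1) = G x i := by
    intro x hx
    rw [(hG x hx).fderiv, innerSL_apply_apply, EuclideanSpace.inner_single_right]
    simp
  have hd : LocallyIntegrableOn (fun x => fderiv ℝ u x (EuclideanSpace.single i 1)) Ω := by
    refine (hGl.euclidean_apply i).congr_ae_restrict ?_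
    filter_upwards [ae_restrict_mem hΩ.measurableSet] with x hx using (e x hx).symm
  have c1 := continuous_fderiv_single h1 i
  have c2 := hasCompactSupport_fderiv_single h2 i
  have c3 := (tsupport_fderiv_single_subset φ i).trans h3
  -- Integration by parts on the whole space: differentiability of `u` is needed only on `tsupport φ
  -- ⊆ Ω`, and `φ` kills whatever `fderiv ℝ u` is outside.
  have := integral_mul_fderiv_eq_neg_fderiv_mul_of_integrable (μ := volume) (f := u) (g := φ)
    (v := EuclideanSpace.single i 1)
    (LocallyIntegrableOn.mul_of_hasCompactSupport h1.continuous h2 hd h3)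
    (LocallyIntegrableOn.mul_of_hasCompactSupport c1 c2 hul c3)
    (LocallyIntegrableOn.mul_of_hasCompactSupport h1.continuous h2 hul h3)
    (fun x hx => (hG x (h3 hx)).differentiableAt)
    (fun x _ => h1.differentiable (by simp) x)
  rw [setIntegral_eq_integral_of_forall_compl_eq_zero, this,
    ← setIntegral_eq_integral_of_forall_compl_eq_zero (s := Ω)]
  · congr 1
    refine setIntegral_congr_fun hΩ.measurableSet fun x hx => ?_
    simp only [e x hx]
  · intro x hx
    rw [image_eq_zero_of_notMem_tsupport (fun h => hx (h3 h)), mul_zero]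
  · intro x hx
    rw [image_eq_zero_of_notMem_tsupport (f := fun x => fderiv ℝ φ x (EuclideanSpace.single i 1))
      (fun h => hx (c3 h)), mul_zero]

theorem isWeakGradient_const (hΩ : IsOpen Ω) (c : ℝ) :
    IsWeakGradient Ω (fun _ => c) (fun _ => (0 : EuclideanSpace ℝ (Fin N))) :=
  isWeakGradient_of_hasFDerivAt hΩ continuousOn_const fun x _ => by
    simpa using hasFDerivAt_const c x

end WeakGradient

/-! ### Polar coordinates and null sets. -/

section Radial

variable {N : ℕ}

theorem setIntegral_unitBall_norm (hN : 1 ≤ N) (f : ℝ → ℝ) :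
    ∫ x in unitBall N, f ‖x‖
      = N * volume.real (unitBall N) * ∫ r in Ioo (0 : ℝ) 1, r ^ (N - 1) * f r := by
  have : Nonempty (Fin N) := ⟨⟨0, hN⟩⟩
  have h := integral_fun_norm_addHaar (volume : Measure (EuclideanSpace ℝ (Fin N)))
    ((Iio (1 : ℝ)).indicator f)
  have e1 : ∫ x in unitBall N, f ‖x‖
      = ∫ x : EuclideanSpace ℝ (Fin N), (Iio (1 : ℝ)).indicator f ‖x‖ := by
    rw [← integral_indicator Metric.isOpen_ball.measurableSet]
    congr 1; ext x
    simp [indicator]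
  have e2 : ∫ r in Ioo (0 : ℝ) 1, r ^ (N - 1) * f r
      = ∫ r in Ioi (0 : ℝ), r ^ (N - 1) • (Iio (1 : ℝ)).indicator f r := by
    rw [← integral_indicator measurableSet_Ioo, ← integral_indicator measurableSet_Ioi]
    congr 1; ext x
    by_cases h0 : 0 < x <;> by_cases h1 : x < 1 <;> simp [indicator, h0, h1]
  rw [e1, e2, h]
  simp only [finrank_euclideanSpace, Fintype.card_fin, nsmul_eq_mul, smul_eq_mul]
  ring

theorem volume_real_unitBall_pos : 0 < volume.real (unitBall N) :=
  ENNReal.toReal_pos (Metric.measure_ball_pos _ _ one_pos).ne' measure_ball_lt_top.ne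

/-- The indicator of `s` is integrated in polar coordinates; the weight `r^{N-1}` is positive on
`(0,1)`, so it does not affect null sets. -/
theorem volume_norm_mem_eq_zero_iff (hN : 1 ≤ N) {s : Set ℝ} (hs : MeasurableSet s) :
    volume.restrict (unitBall N) {x | ‖x‖ ∈ s} = 0 ↔ volume.restrict (Ioo (0 : ℝ) 1) s = 0 := by
  have hm : MeasurableSet {x : EuclideanSpace ℝ (Fin N) | ‖x‖ ∈ s} := measurable_norm hs
  have e := setIntegral_unitBall_norm hN (s.indicator 1)
  have e1 : ∫ x in unitBall N, s.indicator 1 ‖x‖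
      = (volume.restrict (unitBall N)).real {x | ‖x‖ ∈ s} := by
    rw [← integral_indicator_one hm]
    rfl
  have c : 0 < N * volume.real (unitBall N) := by
    have := volume_real_unitBall_pos (N := N)
    positivity
  have : IsFiniteMeasure (volume.restrict (unitBall N)) :=
    ⟨by simpa using measure_ball_lt_top⟩
  have l1 : volume.restrict (unitBall N) {x | ‖x‖ ∈ s} = 0 ↔
      ∫ r in Ioo (0 : ℝ) 1, r ^ (N - 1) * s.indicator 1 r = 0 := by
    rw [← measureReal_eq_zero_iff, ← e1, e, mul_eq_zero, or_iff_right c.ne']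
  have hnn : 0 ≤ᵐ[volume.restrict (Ioo (0 : ℝ) 1)] fun r => r ^ (N - 1) * s.indicator 1 r := by
    filter_upwards [ae_restrict_mem measurableSet_Ioo] with r hr
    exact mul_nonneg (pow_nonneg hr.1.le _) (indicator_nonneg (by simp) _)
  have hint : IntegrableOn (fun r => r ^ (N - 1) * s.indicator (1 : ℝ → ℝ) r) (Ioo (0 : ℝ) 1) := by
    refine Measure.integrableOn_of_bounded (M := 1) (by simp)
      (((measurable_id.pow_const _).mul (measurable_one.indicator hs)).aestronglyMeasurable) ?_
    filter_upwards [ae_restrict_mem measurableSet_Ioo] with r hr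
    rw [norm_mul, norm_pow, Real.norm_of_nonneg hr.1.le]
    refine mul_le_one₀ (pow_le_one₀ hr.1.le hr.2.le) (norm_nonneg _) ?_
    by_cases h : r ∈ s <;> simp [h]
  rw [l1, integral_eq_zero_iff_of_nonneg_ae hnn hint, measure_eq_zero_iff_ae_notMem]
  constructor <;> intro h <;> filter_upwards [h, ae_restrict_mem measurableSet_Ioo] with r hr hr1
  · intro hs
    have : r ^ (N - 1) ≠ 0 := pow_ne_zero _ hr1.1.ne'
    simp [hs, this] at hr
  · simp [hr]

theorem ae_norm_of_ae (hN : 1 ≤ N) {P : ℝ → Prop}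
    (h : ∀ᵐ r ∂volume.restrict (Ioo (0 : ℝ) 1), P r) :
    ∀ᵐ x ∂volume.restrict (unitBall N), P ‖x‖ := by
  obtain ⟨t, ht, htm, ht0⟩ := exists_measurable_superset_of_null (ae_iff.1 h)
  refine measure_mono_null (fun x hx => ?_) ((volume_norm_mem_eq_zero_iff hN htm).2 ht0)
  exact ht hx

theorem ae_of_ae_norm (hN : 1 ≤ N) {P : ℝ → Prop} (hP : MeasurableSet {r | P r})
    (h : ∀ᵐ x ∂volume.restrict (unitBall N), P ‖x‖) :
    ∀ᵐ r ∂volume.restrict (Ioo (0 : ℝ) 1), P r :=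
  (volume_norm_mem_eq_zero_iff hN hP.compl).1 h

end Radial

/-! ### Smooth compactly supported approximation with weighted mean zero. -/

section Approximation

open scoped Convolution in
theorem ContDiffBump.norm_normed_convolution_le {k : ℝ → ℝ} {M : ℝ} (hM : ∀ r, |k r| ≤ M)
    (φ : ContDiffBump (0 : ℝ)) (x : ℝ) :
    |(φ.normed volume ⋆[ContinuousLinearMap.lsmul ℝ ℝ, volume] k) x| ≤ M := by
  rw [convolution_def, ← Real.norm_eq_abs]
  refine (norm_integral_le_of_norm_le (φ.integrable_normed.mul_const M)
    (Eventually.of_forall fun t => ?_)).trans ?_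
  · rw [ContinuousLinearMap.lsmul_apply, norm_smul, Real.norm_of_nonneg (φ.nonneg_normed t)]
    exact mul_le_mul_of_nonneg_left (hM _) (φ.nonneg_normed t)
  · rw [integral_mul_const, φ.integral_normed, one_mul]

theorem integrableOn_pow_mul_of_bounded {f : ℝ → ℝ} (hf : Measurable f) {M : ℝ}
    (hM : ∀ r, |f r| ≤ M) (n : ℕ) : IntegrableOn (fun r => r ^ n * f r) (Ioo (0 : ℝ) 1) := by
  refine Measure.integrableOn_of_bounded (M := M) (by simp)
    ((measurable_id.pow_const _).mul hf).aestronglyMeasurable ?_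
  filter_upwards [ae_restrict_mem measurableSet_Ioo] with r hr
  rw [norm_mul, norm_pow, Real.norm_of_nonneg hr.1.le]
  calc r ^ n * ‖f r‖ ≤ 1 * M :=
        mul_le_mul (pow_le_one₀ hr.1.le hr.2.le) (hM r) (norm_nonneg _) zero_le_one
    _ = M := one_mul M

theorem norm_setIntegral_pow_mul_le {f : ℝ → ℝ} {M : ℝ}
    (hM : ∀ r, |f r| ≤ M) (n : ℕ) : |∫ r in Ioo (0 : ℝ) 1, r ^ n * f r| ≤ M := by
  have := norm_setIntegral_le_of_norm_le_const (μ := volume) (s := Ioo (0 : ℝ) 1) (C := M)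
    (f := fun r => r ^ n * f r) (by simp) (fun r hr => ?_)
  · simpa using this
  · rw [norm_mul, norm_pow, Real.norm_of_nonneg hr.1.le]
    calc r ^ n * ‖f r‖ ≤ 1 * M :=
          mul_le_mul (pow_le_one₀ hr.1.le hr.2.le) (hM r) (norm_nonneg _) zero_le_one
      _ = M := one_mul M

open scoped Convolution in
/-- Bounded functions of weighted mean zero on `(0,1)` are boundedly almost everywhere limits of
smooth functions of weighted mean zero that are compactly supported in `(0,1)`. -/
theorem exists_contDiff_tendsto_of_integral_eq_zero {k : ℝ → ℝ} (hk : Measurable k) {M : ℝ}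
    (hM : ∀ r, |k r| ≤ M) (n : ℕ) (h0 : ∫ r in Ioo (0 : ℝ) 1, r ^ n * k r = 0) :
    ∃ (M' : ℝ) (h : ℕ → ℝ → ℝ), (∀ j, ContDiff ℝ ∞ (h j)) ∧
      (∀ j, ∃ a b, 0 < a ∧ b < 1 ∧ ∀ r ∉ Icc a b, h j r = 0) ∧
      (∀ j r, |h j r| ≤ M') ∧ (∀ j, ∫ r in Ioo (0 : ℝ) 1, r ^ n * h j r = 0) ∧
      ∀ᵐ r ∂volume.restrict (Ioo (0 : ℝ) 1), Tendsto (fun j => h j r) atTop (𝓝 (k r)) := by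
  have hM0 : 0 ≤ M := (abs_nonneg _).trans (hM 0)
  have hq : ∀ j : ℕ, 1 / ((j : ℝ) + 3) ≤ 1 / 3 := fun j => by
    apply one_div_le_one_div_of_le <;> [norm_num; (have : (0 : ℝ) ≤ j := j.cast_nonneg; linarith)]
  have hq0 : ∀ j : ℕ, 0 < 1 / ((j : ℝ) + 3) := fun j => by positivity
  have hlim : Tendsto (fun j : ℕ => 1 / ((j : ℝ) + 3)) atTop (𝓝 0) := by
    have := tendsto_one_div_add_atTop_nhds_zero_nat (𝕜 := ℝ)
    have := (tendsto_add_atTop_iff_nat 2).2 this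
    refine this.congr fun j => ?_
    push_cast; ring
  -- `φ j` mollifies at scale `ε = 1/(j+3)`; `χ j` cuts off near both ends of `(0,1)`. The shift by
  -- `3` gives `ε ≤ 1/3 < 1/2`, so the radii of `χ j` are positive.
  let φ : ℕ → ContDiffBump (0 : ℝ) := fun j =>
    ⟨1 / ((j : ℝ) + 3) / 2, 1 / ((j : ℝ) + 3), by linarith [hq0 j], by linarith [hq0 j]⟩
  let χ : ℕ → ContDiffBump (1 / 2 : ℝ) := fun j =>
    ⟨1 / 2 - 1 / ((j : ℝ) + 3), 1 / 2 - 1 / ((j : ℝ) + 3) / 2, by linarith [hq j],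
      by linarith [hq0 j]⟩
  -- A fixed bump inside `(0,1)` of positive weighted mass; subtracting `c j • θ` restores the mean
  -- zero lost by mollifying and cutting off.
  let θ : ContDiffBump (1 / 2 : ℝ) := ⟨1 / 8, 1 / 4, by norm_num, by norm_num⟩
  let f : ℕ → ℝ → ℝ := fun j =>
    (φ j).normed volume ⋆[ContinuousLinearMap.lsmul ℝ ℝ, volume] k
  have hloc : LocallyIntegrable k := by
    refine (locallyIntegrable_const M).mono hk.aestronglyMeasurable (Eventually.of_forall fun r => ?_)
    rw [Real.norm_of_nonneg hM0]; exact hM r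
  have hfs : ∀ j, ContDiff ℝ ∞ (f j) := fun j =>
    (φ j).hasCompactSupport_normed.contDiff_convolution_left _ (φ j).contDiff_normed hloc
  have hfM : ∀ j r, |χ j r * f j r| ≤ M := by
    intro j r
    rw [abs_mul, abs_of_nonneg (χ j).nonneg]
    calc χ j r * |f j r| ≤ 1 * M :=
          mul_le_mul (χ j).le_one ((φ j).norm_normed_convolution_le hM r) (abs_nonneg _) zero_le_one
      _ = M := one_mul M
  have hfl : ∀ᵐ r ∂volume.restrict (Ioo (0 : ℝ) 1),
      Tendsto (fun j => χ j r * f j r) atTop (𝓝 (k r)) := by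
    have := ContDiffBump.ae_convolution_tendsto_right_of_locallyIntegrable (μ := volume)
      (φ := φ) (l := atTop) (K := 2) hlim
      (Eventually.of_forall fun j => by simp only [φ]; linarith) hloc
    filter_upwards [ae_restrict_of_ae this, ae_restrict_mem measurableSet_Ioo] with r hr hr1
    have hev : ∀ᶠ j in atTop, χ j r = 1 := by
      have hd : 0 < 1 / 2 - |r - 1 / 2| := by
        rcases abs_cases (r - 1 / 2) with h | h <;> linarith [hr1.1, hr1.2]
      filter_upwards [hlim.eventually (gt_mem_nhds hd)] with j hj
      apply (χ j).one_of_mem_closedBall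
      rw [Metric.mem_closedBall, Real.dist_eq]
      simp only [χ]; linarith
    refine hr.congr' ?_
    filter_upwards [hev] with j hj
    rw [hj, one_mul]
  have hfm : ∀ j, Measurable fun r => χ j r * f j r := fun j =>
    ((χ j).continuous.mul (hfs j).continuous).measurable
  have hθm : Measurable θ := θ.continuous.measurable
  have hθ1 : ∀ r, |θ r| ≤ 1 := fun r => by rw [abs_of_nonneg θ.nonneg]; exact θ.le_one
  have hθi := integrableOn_pow_mul_of_bounded hθm hθ1 n
  set I0 := ∫ r in Ioo (0 : ℝ) 1, r ^ n * θ r with hI0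
  have hI0pos : 0 < I0 := by
    rw [hI0, setIntegral_pos_iff_support_of_nonneg_ae _ hθi]
    · refine lt_of_lt_of_le ?_ (measure_mono (s := Ioo (1 / 4 : ℝ) (3 / 4)) ?_)
      · simp only [Real.volume_Ioo]; norm_num
      · intro r hr
        refine ⟨?_, by constructor <;> linarith [hr.1, hr.2]⟩
        have : r ∈ Function.support θ := by
          rw [θ.support_eq, Metric.mem_ball, Real.dist_eq, abs_lt]
          constructor <;> simp only [θ] <;> linarith [hr.1, hr.2]
        exact mul_ne_zero (pow_ne_zero _ (by linarith [hr.1])) this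
    · filter_upwards [ae_restrict_mem measurableSet_Ioo] with r hr
      exact mul_nonneg (pow_nonneg hr.1.le _) θ.nonneg
  let c : ℕ → ℝ := fun j => (∫ r in Ioo (0 : ℝ) 1, r ^ n * (χ j r * f j r)) / I0
  have hc : ∀ j, |c j| ≤ M / I0 := fun j => by
    rw [abs_div, abs_of_pos hI0pos]
    exact div_le_div_of_nonneg_right (norm_setIntegral_pow_mul_le (hfM j) n) hI0pos.le
  -- The correction vanishes in the limit because `k` itself has weighted mean zero.
  have hcl : Tendsto c atTop (𝓝 0) := by
    have : Tendsto (fun j => ∫ r in Ioo (0 : ℝ) 1, r ^ n * (χ j r * f j r)) atTop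
        (𝓝 (∫ r in Ioo (0 : ℝ) 1, r ^ n * k r)) := by
      refine tendsto_integral_of_dominated_convergence (fun _ => M)
        (fun j => ((measurable_id.pow_const _).mul (hfm j)).aestronglyMeasurable)
        (integrable_const M) (fun j => ?_) ?_
      · filter_upwards [ae_restrict_mem measurableSet_Ioo] with r hr
        rw [norm_mul, norm_pow, Real.norm_of_nonneg hr.1.le]
        calc r ^ n * ‖χ j r * f j r‖ ≤ 1 * M :=
              mul_le_mul (pow_le_one₀ hr.1.le hr.2.le) (hfM j r) (norm_nonneg _) zero_le_one
          _ = M := one_mul M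
      · filter_upwards [hfl] with r hr using hr.const_mul _
    rw [h0] at this
    simpa using this.div_const I0
  refine ⟨M + M / I0, fun j r => χ j r * f j r - c j * θ r, fun j => ?_, fun j => ?_,
    fun j r => ?_, fun j => ?_, ?_⟩
  · exact ((χ j).contDiff.mul (hfs j)).sub (contDiff_const.mul θ.contDiff)
  · refine ⟨1 / ((j : ℝ) + 3) / 2, 1 - 1 / ((j : ℝ) + 3) / 2, by linarith [hq0 j],
      by linarith [hq0 j], fun r hr => ?_⟩
    have hr' : 1 / 2 - 1 / ((j : ℝ) + 3) / 2 ≤ |r - 1 / 2| := by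
      by_contra hlt
      rw [not_le, abs_lt] at hlt
      exact hr ⟨by linarith [hlt.1], by linarith [hlt.2]⟩
    change χ j r * f j r - c j * θ r = 0
    rw [(χ j).zero_of_le_dist (by rw [Real.dist_eq]; exact hr'),
      θ.zero_of_le_dist (by rw [Real.dist_eq]; simp only [θ]; linarith [hq j])]
    ring
  · refine (abs_sub _ _).trans (add_le_add (hfM j r) ?_)
    rw [abs_mul]
    calc |c j| * |θ r| ≤ M / I0 * 1 :=
          mul_le_mul (hc j) (hθ1 r) (abs_nonneg _) (div_nonneg hM0 hI0pos.le)
      _ = M / I0 := mul_one _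
  · have e : ∀ r : ℝ, r ^ n * (χ j r * f j r - c j * θ r)
        = r ^ n * (χ j r * f j r) - c j * (r ^ n * θ r) := fun r => by ring
    simp only [e]
    rw [integral_sub (integrableOn_pow_mul_of_bounded (hfm j) (hfM j) n) (hθi.const_mul _),
      integral_const_mul, ← hI0]
    simp only [c]
    field_simp
    ring
  · filter_upwards [hfl] with r hr
    simpa using hr.sub (hcl.mul_const (θ r))

end Approximation

/-! ### The divergence theorem for radial fields. -/

section RadialDivergence

variable {N : ℕ}

theorem hasFDerivAt_norm_of_ne_zero {E : Type*} [NormedAddCommGroup E] [InnerProductSpace ℝ E]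
    {x : E} (hx : x ≠ 0) : HasFDerivAt (fun y : E => ‖y‖) (‖x‖⁻¹ • innerSL ℝ x) x := by
  have h := (hasStrictFDerivAt_norm_sq x).hasFDerivAt.sqrt (pow_ne_zero 2 (norm_ne_zero_iff.2 hx))
  simp only [Real.sqrt_sq (norm_nonneg _)] at h
  convert h using 1
  rw [← Nat.cast_smul_eq_nsmul ℝ, smul_smul]
  congr 1
  push_cast
  field_simp

theorem setIntegral_Ioo_eq_intervalIntegral (f : ℝ → ℝ) {b : ℝ} (hb : 0 ≤ b) :
    ∫ r in (0 : ℝ)..b, f r = ∫ r in Ioo (0 : ℝ) b, f r := by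
  rw [intervalIntegral.integral_of_le hb, integral_Ioc_eq_integral_Ioo]

/-- The primitive `r ↦ ∫_0^r s^n f(s) ds`. -/
noncomputable def weightedPrimitive (n : ℕ) (f : ℝ → ℝ) (r : ℝ) : ℝ := ∫ s in (0 : ℝ)..r, s ^ n * f s

/-- For `n + 1 = N` this bounds the field `H(|x|) x / |x|^N` by a constant times `|x|`, so it is not
singular at the origin. -/
theorem abs_weightedPrimitive_le {n : ℕ} {f : ℝ → ℝ} {M : ℝ} (hM : ∀ r, |f r| ≤ M) (r : ℝ) :
    |weightedPrimitive n f r| ≤ M * |r| ^ (n + 1) := by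
  have := intervalIntegral.norm_integral_le_of_norm_le_const (a := 0) (b := r)
    (f := fun s => s ^ n * f s) (C := |r| ^ n * M) (fun s hs => ?_)
  · rw [sub_zero, Real.norm_eq_abs] at this
    refine this.trans (le_of_eq ?_)
    ring
  · have hsr : |s| ≤ |r| := by
      rcases le_total 0 r with h | h
      · rw [uIoc_of_le h] at hs
        rw [abs_of_pos hs.1, abs_of_nonneg h]; exact hs.2
      · rw [uIoc_of_ge h] at hs
        rw [abs_of_nonpos hs.2, abs_of_nonpos h]; linarith [hs.1]
    rw [norm_mul, norm_pow]
    exact mul_le_mul (pow_le_pow_left₀ (abs_nonneg _) hsr _) (hM s) (norm_nonneg _) (by positivity)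

theorem hasDerivAt_weightedPrimitive {n : ℕ} {f : ℝ → ℝ} (hf : Continuous f) (r : ℝ) :
    HasDerivAt (weightedPrimitive n f) (r ^ n * f r) r := by
  have hc : Continuous fun s : ℝ => s ^ n * f s := by fun_prop
  exact intervalIntegral.integral_hasDerivAt_right (hc.intervalIntegrable _ _)
    (hc.stronglyMeasurableAtFilter _ _) hc.continuousAt

theorem contDiff_weightedPrimitive {n : ℕ} {f : ℝ → ℝ} (hf : ContDiff ℝ ∞ f) :
    ContDiff ℝ ∞ (weightedPrimitive n f) := by
  rw [contDiff_infty_iff_deriv]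
  have hd := fun r => hasDerivAt_weightedPrimitive (n := n) hf.continuous r
  refine ⟨fun r => (hd r).differentiableAt, ?_⟩
  rw [funext fun r => (hd r).deriv]
  fun_prop

/-- Below `a` nothing has been integrated yet; beyond `b` the primitive already equals the total
integral, which is zero. -/
theorem weightedPrimitive_eq_zero {n : ℕ} {f : ℝ → ℝ} {a b : ℝ} (ha : 0 < a) (hb : b < 1)
    (hf : Continuous f) (hab : ∀ r ∉ Icc a b, f r = 0)
    (h0 : ∫ r in Ioo (0 : ℝ) 1, r ^ n * f r = 0) {r : ℝ} (hr : r ∉ Icc a b) :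
    weightedPrimitive n f r = 0 := by
  rw [mem_Icc, not_and_or, not_le, not_le] at hr
  rcases hr with hr | hr
  · refine intervalIntegral.integral_zero_ae (Eventually.of_forall fun s hs => ?_)
    have : s < a := by
      rcases le_total 0 r with h | h
      · rw [uIoc_of_le h] at hs; linarith [hs.2]
      · rw [uIoc_of_ge h] at hs; linarith [hs.2]
    rw [hab s (fun h => by linarith [h.1]), mul_zero]
  · have hc : Continuous fun s : ℝ => s ^ n * f s := by fun_prop
    have e := intervalIntegral.integral_add_adjacent_intervals
      (hc.intervalIntegrable (μ := volume) 0 r) (hc.intervalIntegrable r 1)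
    have e1 : ∫ s in r..1, s ^ n * f s = 0 := by
      refine intervalIntegral.integral_zero_ae (Eventually.of_forall fun s hs => ?_)
      have : b < s := by
        rcases le_total r 1 with h | h
        · rw [uIoc_of_le h] at hs; linarith [hs.1]
        · rw [uIoc_of_ge h] at hs; linarith [hs.1]
      rw [hab s (fun h => by linarith [h.2]), mul_zero]
    rw [setIntegral_Ioo_eq_intervalIntegral _ zero_le_one |>.symm] at h0
    rw [weightedPrimitive]
    linarith

/-- The divergence theorem for smooth compactly supported radial vector fields, tested with a
weakly differentiable function. -/
theorem IsWeakGradient.integral_mul_norm_of_contDiff (hN : 1 ≤ N)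
    {u : EuclideanSpace ℝ (Fin N) → ℝ} {G : EuclideanSpace ℝ (Fin N) → EuclideanSpace ℝ (Fin N)}
    (hG : IsWeakGradient (unitBall N) u G) {η : ℝ → ℝ} (hη : ContDiff ℝ ∞ η) {a b : ℝ}
    (ha : 0 < a) (hb : b < 1) (hab : ∀ r ∉ Icc a b, η r = 0)
    (h0 : ∫ r in Ioo (0 : ℝ) 1, r ^ (N - 1) * η r = 0) :
    ∫ x in unitBall N, u x * η ‖x‖ = -∫ x in unitBall N,
      weightedPrimitive (N - 1) η ‖x‖ * (‖x‖ ^ N)⁻¹ * inner ℝ x (G x) := by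
  set H := weightedPrimitive (N - 1) η with hH
  have hHs : ContDiff ℝ ∞ H := contDiff_weightedPrimitive hη
  have hHd := fun r => hasDerivAt_weightedPrimitive (n := N - 1) hη.continuous r
  have hH0 : ∀ r ∉ Icc a b, H r = 0 := fun r hr =>
    weightedPrimitive_eq_zero ha hb hη.continuous hab h0 hr
  -- The components of the field `H(|x|) x / |x|^N`, which has divergence `η(|x|)`. It vanishes near
  -- the origin and near the sphere, so each component is an admissible test function.
  let φ : Fin N → EuclideanSpace ℝ (Fin N) → ℝ := fun i x => H ‖x‖ * (‖x‖ ^ N)⁻¹ * x i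
  have hφ0 : ∀ i x, ‖x‖ ∉ Icc a b → φ i x = 0 := fun i x hx => by
    simp only [φ, hH0 _ hx, zero_mul]
  have hev : ∀ x : EuclideanSpace ℝ (Fin N), ‖x‖ < a → ∀ i, φ i =ᶠ[𝓝 x] fun _ => 0 := by
    intro x hx i
    filter_upwards [(continuous_norm.tendsto x).eventually (gt_mem_nhds hx)] with y hy
    exact hφ0 i y fun h => by linarith [h.1]
  have hφs : ∀ i, ContDiff ℝ ∞ (φ i) := by
    intro i
    rw [contDiff_iff_contDiffAt]
    intro x
    rcases lt_or_ge ‖x‖ a with hx | hx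
    · exact contDiffAt_const.congr_of_eventuallyEq (hev x hx i)
    · have hx0 : x ≠ 0 := norm_pos_iff.1 (ha.trans_le hx)
      have hn : ContDiffAt ℝ ∞ (fun y : EuclideanSpace ℝ (Fin N) => ‖y‖) x := contDiffAt_norm ℝ hx0
      have hi : ContDiffAt ℝ ∞ (fun y : EuclideanSpace ℝ (Fin N) => y i) x :=
        (EuclideanSpace.proj (𝕜 := ℝ) i).contDiff.contDiffAt
      exact ((hHs.contDiffAt.comp x hn).mul
        ((hn.pow N).inv (pow_ne_zero _ (norm_ne_zero_iff.2 hx0)))).mul hi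
  have hts : ∀ i, tsupport (φ i) ⊆ Metric.closedBall 0 b := by
    intro i
    refine closure_minimal (fun x hx => ?_) Metric.isClosed_closedBall
    by_contra hxb
    rw [mem_closedBall_zero_iff] at hxb
    exact hx (hφ0 i x fun h => hxb h.2)
  have hcs : ∀ i, HasCompactSupport (φ i) := fun i =>
    (isCompact_closedBall 0 b).of_isClosed_subset (isClosed_tsupport _) (hts i)
  have hsub : ∀ i, tsupport (φ i) ⊆ unitBall N := fun i =>
    (hts i).trans (Metric.closedBall_subset_ball hb)
  have hdiv : ∀ x : EuclideanSpace ℝ (Fin N),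
      ∑ i, fderiv ℝ (φ i) x (EuclideanSpace.single i 1) = η ‖x‖ := by
    intro x
    rcases lt_or_ge ‖x‖ a with hx | hx
    · rw [hab _ (fun h => by linarith [h.1])]
      refine Finset.sum_eq_zero fun i _ => ?_
      rw [(hev x hx i).fderiv_eq]
      simp
    · have hx0 : x ≠ 0 := norm_pos_iff.1 (ha.trans_le hx)
      have hr0 : ‖x‖ ≠ 0 := norm_ne_zero_iff.2 hx0
      have hK : HasDerivAt (fun r : ℝ => H r * (r ^ N)⁻¹)
          (‖x‖ ^ (N - 1) * η ‖x‖ * (‖x‖ ^ N)⁻¹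
            + H ‖x‖ * (-(N * ‖x‖ ^ (N - 1)) / (‖x‖ ^ N) ^ 2)) ‖x‖ :=
        (hHd ‖x‖).mul ((hasDerivAt_pow N ‖x‖).inv (pow_ne_zero _ hr0))
      have hF : ∀ i, fderiv ℝ (φ i) x (EuclideanSpace.single i 1)
          = H ‖x‖ * (‖x‖ ^ N)⁻¹ + (‖x‖ ^ (N - 1) * η ‖x‖ * (‖x‖ ^ N)⁻¹
            + H ‖x‖ * (-(N * ‖x‖ ^ (N - 1)) / (‖x‖ ^ N) ^ 2)) * ‖x‖⁻¹ * x i ^ 2 := by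
        intro i
        have h1 := hK.comp_hasFDerivAt x (hasFDerivAt_norm_of_ne_zero hx0)
        have h2 := (EuclideanSpace.proj (𝕜 := ℝ) i).hasFDerivAt (x := x)
        have h3 : HasFDerivAt (φ i) _ x := h1.mul h2
        rw [h3.fderiv]
        simp [EuclideanSpace.inner_single_right]
        ring
      simp only [hF]
      rw [Finset.sum_add_distrib, Finset.sum_const, ← Finset.mul_sum, ← EuclideanSpace.real_norm_sq_eq]
      simp only [Finset.card_univ, Fintype.card_fin, nsmul_eq_mul]
      obtain ⟨n, rfl⟩ : ∃ n, N = n + 1 := ⟨N - 1, by omega⟩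
      simp only [Nat.add_sub_cancel]
      field_simp
      ring
  have hI1 : ∀ i ∈ Finset.univ, Integrable (fun x => u x * fderiv ℝ (φ i) x
      (EuclideanSpace.single i 1)) (volume.restrict (unitBall N)) := fun i _ =>
    (LocallyIntegrableOn.mul_of_hasCompactSupport (continuous_fderiv_single (hφs i) i)
      (hasCompactSupport_fderiv_single (hcs i) i) hG.1
      ((tsupport_fderiv_single_subset _ i).trans (hsub i))).restrict
  have hI2 : ∀ i ∈ Finset.univ, Integrable (fun x => G x i * φ i x)
      (volume.restrict (unitBall N)) := fun i _ =>
    (LocallyIntegrableOn.mul_of_hasCompactSupport (hφs i).continuous (hcs i)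
      (hG.2.1.euclidean_apply i) (hsub i)).restrict
  calc ∫ x in unitBall N, u x * η ‖x‖
      = ∫ x in unitBall N, ∑ i, u x * fderiv ℝ (φ i) x (EuclideanSpace.single i 1) := by
        simp only [← Finset.mul_sum, hdiv]
    _ = ∑ i, ∫ x in unitBall N, u x * fderiv ℝ (φ i) x (EuclideanSpace.single i 1) :=
        integral_finsetSum _ hI1
    _ = -∫ x in unitBall N, ∑ i, G x i * φ i x := by
        rw [integral_finsetSum _ hI2, ← Finset.sum_neg_distrib]
        exact Finset.sum_congr rfl fun i _ => hG.2.2 (φ i) (hφs i) (hcs i) (hsub i) i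
    _ = _ := by
        congr 2; ext x
        rw [PiLp.inner_apply, Finset.mul_sum]
        refine Finset.sum_congr rfl fun i _ => ?_
        simp only [φ, RCLike.inner_apply, conj_trivial]
        ring

/-- The divergence theorem for bounded radial right-hand sides of mean zero: the radial vector
field with divergence `k(|x|)` has vanishing flux through the boundary of the unit ball. -/
theorem IsWeakGradient.integral_mul_norm (hN : 1 ≤ N)
    {u : EuclideanSpace ℝ (Fin N) → ℝ} {G : EuclideanSpace ℝ (Fin N) → EuclideanSpace ℝ (Fin N)}
    (hG : IsWeakGradient (unitBall N) u G) (hui : IntegrableOn u (unitBall N))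
    (hGi : IntegrableOn G (unitBall N)) {k : ℝ → ℝ} (hk : Measurable k) {M : ℝ}
    (hM : ∀ r, |k r| ≤ M) (h0 : ∫ r in Ioo (0 : ℝ) 1, r ^ (N - 1) * k r = 0) :
    ∫ x in unitBall N, u x * k ‖x‖ = -∫ x in unitBall N,
      weightedPrimitive (N - 1) k ‖x‖ * (‖x‖ ^ N)⁻¹ * inner ℝ x (G x) := by
  -- The smooth case is applied to approximations of `k`; both sides pass to the limit by dominated
  -- convergence.
  obtain ⟨M', h, hs, hc, hb, hz, hl⟩ := exists_contDiff_tendsto_of_integral_eq_zero hk hM (N - 1) h0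
  have hM0 : 0 ≤ M' := (abs_nonneg _).trans (hb 0 0)
  have hNe : N - 1 + 1 = N := by omega
  have L1 : Tendsto (fun j => ∫ x in unitBall N, u x * h j ‖x‖) atTop
      (𝓝 (∫ x in unitBall N, u x * k ‖x‖)) := by
    refine tendsto_integral_of_dominated_convergence (fun x => ‖u x‖ * M')
      (fun j => hui.aestronglyMeasurable.mul
        ((hs j).continuous.comp continuous_norm).aestronglyMeasurable)
      (hui.norm.mul_const _) (fun j => Eventually.of_forall fun x => ?_) ?_
    · rw [norm_mul]
      exact mul_le_mul_of_nonneg_left (hb j _) (norm_nonneg _)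
    · filter_upwards [ae_norm_of_ae hN hl] with x hx using hx.const_mul _
  have hprim : ∀ r ∈ Ioo (0 : ℝ) 1, Tendsto (fun j => weightedPrimitive (N - 1) (h j) r) atTop
      (𝓝 (weightedPrimitive (N - 1) k r)) := by
    intro r hr
    refine intervalIntegral.tendsto_integral_filter_of_dominated_convergence (fun _ => M')
      (Eventually.of_forall fun j =>
        ((continuous_id.pow _).mul (hs j).continuous).aestronglyMeasurable)
      (Eventually.of_forall fun j => Eventually.of_forall fun s hs' => ?_)
      intervalIntegrable_const ?_
    · rw [uIoc_of_le hr.1.le] at hs'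
      rw [norm_mul, norm_pow, Real.norm_of_nonneg hs'.1.le]
      calc s ^ (N - 1) * ‖h j s‖ ≤ 1 * M' :=
            mul_le_mul (pow_le_one₀ hs'.1.le (hs'.2.trans hr.2.le)) (hb j s) (norm_nonneg _)
              zero_le_one
        _ = M' := one_mul _
    · rw [ae_restrict_iff' measurableSet_Ioo] at hl
      filter_upwards [hl] with s hs1 hs'
      rw [uIoc_of_le hr.1.le] at hs'
      exact (hs1 ⟨hs'.1, hs'.2.trans_lt hr.2⟩).const_mul _
  have L2 : Tendsto (fun j => ∫ x in unitBall N,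
      weightedPrimitive (N - 1) (h j) ‖x‖ * (‖x‖ ^ N)⁻¹ * inner ℝ x (G x)) atTop
      (𝓝 (∫ x in unitBall N,
        weightedPrimitive (N - 1) k ‖x‖ * (‖x‖ ^ N)⁻¹ * inner ℝ x (G x))) := by
    refine tendsto_integral_of_dominated_convergence (fun x => M' * ‖G x‖)
      (fun j => ?_) (hGi.norm.const_mul _) (fun j => ?_) ?_
    · refine AEStronglyMeasurable.mul (Measurable.aestronglyMeasurable ?_)
        (aestronglyMeasurable_id.inner hGi.aestronglyMeasurable)
      exact ((contDiff_weightedPrimitive (hs j)).continuous.measurable.comp measurable_norm).mul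
        (measurable_norm.pow_const _).inv
    · filter_upwards [ae_restrict_mem Metric.isOpen_ball.measurableSet] with x hx
      rw [mem_ball_zero_iff] at hx
      have h1 := abs_weightedPrimitive_le (n := N - 1) (hb j) ‖x‖
      rw [hNe, abs_norm] at h1
      have h2 : |weightedPrimitive (N - 1) (h j) ‖x‖| * (‖x‖ ^ N)⁻¹ ≤ M' := by
        rw [← div_eq_mul_inv]
        exact div_le_of_le_mul₀ (by positivity) hM0 h1
      have h3 : ‖inner ℝ x (G x)‖ ≤ ‖G x‖ :=
        (norm_inner_le_norm x (G x)).trans (mul_le_of_le_one_left (norm_nonneg _) hx.le)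
      rw [norm_mul, norm_mul, norm_inv, norm_pow, norm_norm]
      exact mul_le_mul h2 h3 (norm_nonneg _) hM0
    · have : ∀ᵐ x ∂volume.restrict (unitBall N), ‖x‖ ∈ Ioo (0 : ℝ) 1 :=
        ae_norm_of_ae hN (ae_restrict_mem measurableSet_Ioo)
      filter_upwards [this] with x hx
      exact ((hprim _ hx).mul_const _).mul_const _
  refine tendsto_nhds_unique L1 (L2.neg.congr fun j => ?_)
  obtain ⟨a, b, ha, hb', hab⟩ := hc j
  exact (hG.integral_mul_norm_of_contDiff hN (hs j) ha hb' hab (hz j)).symm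

end RadialDivergence

/-! ### Strict monotonicity of the p-Laplacian flux. -/

section FluxMonotone

variable {α V : Type*} [MeasurableSpace α] {μ : Measure α} [NormedAddCommGroup V]
  [InnerProductSpace ℝ V] {p : ℝ}

/-- The exponent `p - 2` may be negative, but at `t = 0` its power is multiplied by `0`; `1 < p`
makes the right side vanish there too. -/
theorem Real.rpow_sub_two_mul_self {p : ℝ} (hp1 : 1 < p) {t : ℝ} (ht : 0 ≤ t) :
    t ^ (p - 2) * t = t ^ (p - 1) := by
  rcases ht.eq_or_lt with rfl | h
  · rw [mul_zero, Real.zero_rpow (by linarith)]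
  · rw [← Real.rpow_add_one h.ne']; ring_nf

theorem Real.rpow_sub_one_mul_self {p : ℝ} (hp1 : 1 < p) {t : ℝ} (ht : 0 ≤ t) :
    t ^ (p - 1) * t = t ^ p := by
  rcases ht.eq_or_lt with rfl | h
  · rw [mul_zero, Real.zero_rpow (by linarith)]
  · rw [← Real.rpow_add_one h.ne']; ring_nf

theorem flux_inner_self (hp1 : 1 < p) (a : V) : ‖a‖ ^ (p - 2) * inner ℝ a a = ‖a‖ ^ p := by
  rw [real_inner_self_eq_norm_sq, sq, ← mul_assoc,
    Real.rpow_sub_two_mul_self hp1 (norm_nonneg a), Real.rpow_sub_one_mul_self hp1 (norm_nonneg a)]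

theorem abs_flux_inner_le (hp1 : 1 < p) (a b : V) :
    |‖a‖ ^ (p - 2) * inner ℝ a b| ≤ ‖a‖ ^ (p - 1) * ‖b‖ := by
  rw [abs_mul, abs_of_nonneg (Real.rpow_nonneg (norm_nonneg a) _),
    ← Real.rpow_sub_two_mul_self hp1 (norm_nonneg a), mul_assoc]
  exact mul_le_mul_of_nonneg_left (abs_real_inner_le_norm a b) (Real.rpow_nonneg (norm_nonneg a) _)

/-- Both terms on the right are nonnegative: the first by monotonicity of `t ↦ t^{p-1}`, the second
by Cauchy–Schwarz. This gives monotonicity and its equality case at once. -/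
theorem flux_sub_inner_sub (hp1 : 1 < p) (a b : V) :
    ‖a‖ ^ (p - 2) * inner ℝ a (a - b) - ‖b‖ ^ (p - 2) * inner ℝ b (a - b)
      = (‖a‖ ^ (p - 1) - ‖b‖ ^ (p - 1)) * (‖a‖ - ‖b‖)
        + (‖a‖ ^ (p - 2) + ‖b‖ ^ (p - 2)) * (‖a‖ * ‖b‖ - inner ℝ a b) := by
  rw [inner_sub_right, inner_sub_right, real_inner_self_eq_norm_sq, real_inner_self_eq_norm_sq,
    real_inner_comm a b, ← Real.rpow_sub_two_mul_self hp1 (norm_nonneg a),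
    ← Real.rpow_sub_two_mul_self hp1 (norm_nonneg b)]
  ring

theorem rpow_sub_mul_sub_nonneg {s : ℝ} (hs : 0 < s) {x y : ℝ} (hx : 0 ≤ x) (hy : 0 ≤ y) :
    0 ≤ (x ^ s - y ^ s) * (x - y) := by
  rcases le_total x y with h | h
  · exact mul_nonneg_of_nonpos_of_nonpos (sub_nonpos.2 (Real.rpow_le_rpow hx h hs.le))
      (sub_nonpos.2 h)
  · exact mul_nonneg (sub_nonneg.2 (Real.rpow_le_rpow hy h hs.le)) (sub_nonneg.2 h)

theorem flux_sub_inner_sub_nonneg (hp1 : 1 < p) (a b : V) :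
    0 ≤ ‖a‖ ^ (p - 2) * inner ℝ a (a - b) - ‖b‖ ^ (p - 2) * inner ℝ b (a - b) := by
  rw [flux_sub_inner_sub hp1]
  have h1 := rpow_sub_mul_sub_nonneg (s := p - 1) (by linarith) (norm_nonneg a) (norm_nonneg b)
  have h2 := real_inner_le_norm a b
  have h3 := Real.rpow_nonneg (norm_nonneg a) (p - 2)
  have h4 := Real.rpow_nonneg (norm_nonneg b) (p - 2)
  have := mul_nonneg (add_nonneg h3 h4) (sub_nonneg.2 h2)
  linarith

theorem eq_of_flux_sub_inner_sub_eq_zero (hp1 : 1 < p) {a b : V}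
    (h : ‖a‖ ^ (p - 2) * inner ℝ a (a - b) - ‖b‖ ^ (p - 2) * inner ℝ b (a - b) = 0) : a = b := by
  rw [flux_sub_inner_sub hp1] at h
  have h1 := rpow_sub_mul_sub_nonneg (s := p - 1) (by linarith) (norm_nonneg a) (norm_nonneg b)
  have h2 := sub_nonneg.2 (real_inner_le_norm a b)
  have h3 := Real.rpow_nonneg (norm_nonneg a) (p - 2)
  have h4 := Real.rpow_nonneg (norm_nonneg b) (p - 2)
  have h5 := mul_nonneg (add_nonneg h3 h4) h2
  have e1 : (‖a‖ ^ (p - 1) - ‖b‖ ^ (p - 1)) * (‖a‖ - ‖b‖) = 0 := by linarith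
  have e2 : (‖a‖ ^ (p - 2) + ‖b‖ ^ (p - 2)) * (‖a‖ * ‖b‖ - inner ℝ a b) = 0 := by linarith
  have hn : ‖a‖ = ‖b‖ := by
    rcases mul_eq_zero.1 e1 with e | e
    · exact (Real.rpow_left_inj (norm_nonneg a) (norm_nonneg b)
        (sub_pos.2 hp1).ne').1 (sub_eq_zero.1 e)
    · linarith
  -- For `a = 0` the weight `‖a‖ ^ (p - 2)` need not be positive, but equal norms already suffice.
  rcases eq_or_ne a 0 with rfl | ha
  · rw [norm_zero] at hn
    exact (norm_eq_zero.1 hn.symm).symm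
  · have : 0 < ‖a‖ ^ (p - 2) := Real.rpow_pos_of_pos (norm_pos_iff.2 ha) _
    have hi : inner ℝ a b = ‖a‖ * ‖b‖ := by
      rcases mul_eq_zero.1 e2 with e | e <;> linarith
    rw [← sub_eq_zero, ← norm_eq_zero, ← sq_eq_zero_iff, norm_sub_sq_real, hi, hn]
    ring

theorem integrable_flux_inner (hp1 : 1 < p) {F G : α → V}
    (hF : MemLp F (ENNReal.ofReal p) μ) (hG : MemLp G (ENNReal.ofReal p) μ) :
    Integrable (fun x => ‖F x‖ ^ (p - 2) * inner ℝ (F x) (G x)) μ := by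
  have hp0 : ENNReal.ofReal p ≠ 0 := by simp; linarith
  have iF := hF.integrable_norm_rpow hp0 (by simp)
  have iG := hG.integrable_norm_rpow hp0 (by simp)
  rw [ENNReal.toReal_ofReal (by linarith)] at iF iG
  refine (iF.add iG).mono' ?_ (Eventually.of_forall fun x => ?_)
  · exact (hF.1.norm.aemeasurable.pow_const _).aestronglyMeasurable.mul (hF.1.inner hG.1)
  · refine (abs_flux_inner_le hp1 _ _).trans ?_
    have hx := norm_nonneg (F x)
    have hy := norm_nonneg (G x)
    simp only [Pi.add_apply]
    -- A crude Young inequality: `‖F‖^{p-1} ‖G‖` is at most the `p`-th power of the larger norm.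
    rcases le_total ‖F x‖ ‖G x‖ with h | h
    · have := mul_le_mul_of_nonneg_right (Real.rpow_le_rpow hx h (by linarith : 0 ≤ p - 1)) hy
      rw [Real.rpow_sub_one_mul_self hp1 hy] at this
      linarith [Real.rpow_nonneg hx p]
    · have := mul_le_mul_of_nonneg_left h (Real.rpow_nonneg hx (p - 1))
      rw [Real.rpow_sub_one_mul_self hp1 hx] at this
      linarith [Real.rpow_nonneg hy p]

theorem ae_eq_of_integral_flux_inner_sub_eq (hp1 : 1 < p) {F G : α → V}
    (hF : MemLp F (ENNReal.ofReal p) μ) (hG : MemLp G (ENNReal.ofReal p) μ)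
    (h : ∫ x, ‖F x‖ ^ (p - 2) * inner ℝ (F x) (F x - G x) ∂μ
      = ∫ x, ‖G x‖ ^ (p - 2) * inner ℝ (G x) (F x - G x) ∂μ) : F =ᵐ[μ] G := by
  have i1 : Integrable (fun x => ‖F x‖ ^ (p - 2) * inner ℝ (F x) (F x - G x)) μ :=
    integrable_flux_inner hp1 hF (hF.sub hG)
  have i2 : Integrable (fun x => ‖G x‖ ^ (p - 2) * inner ℝ (G x) (F x - G x)) μ :=
    integrable_flux_inner hp1 hG (hF.sub hG)
  have h0 := sub_eq_zero.2 h
  rw [← integral_sub i1 i2, integral_eq_zero_iff_of_nonneg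
    (fun x => flux_sub_inner_sub_nonneg hp1 (F x) (G x)) (i1.sub i2)] at h0
  filter_upwards [h0] with x hx using eq_of_flux_sub_inner_sub_eq_zero hp1 hx

end FluxMonotone

/-! ### Radial functions with a `C^1` profile. -/

section RadialPrimitive

variable {N : ℕ}

/-- The norm is not differentiable at the origin in general; `W'(0) = 0` makes `W ‖y‖ - W 0 =
o(‖y‖)`. -/
theorem hasFDerivAt_comp_norm {E : Type*} [NormedAddCommGroup E] [InnerProductSpace ℝ E]
    {W ρ : ℝ → ℝ} (hW : ∀ r, HasDerivAt W (ρ r) r) (hρ0 : ρ 0 = 0) (x : E) :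
    HasFDerivAt (fun y : E => W ‖y‖) (innerSL ℝ ((ρ ‖x‖ * ‖x‖⁻¹) • x)) x := by
  rcases eq_or_ne x 0 with rfl | hx
  · have h := hW 0
    rw [hρ0, hasDerivAt_iff_isLittleO_nhds_zero] at h
    rw [smul_zero, map_zero, hasFDerivAt_iff_isLittleO_nhds_zero]
    have ht : Tendsto (fun y : E => ‖y‖) (𝓝 0) (𝓝 0) := by
      simpa using (continuous_norm (E := E)).tendsto 0
    have := h.comp_tendsto ht
    refine Asymptotics.isLittleO_norm_right.1 ?_
    simpa [Function.comp_def] using this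
  · have h := (hW ‖x‖).comp_hasFDerivAt x (hasFDerivAt_norm_of_ne_zero hx)
    rw [map_smul, mul_smul]
    exact h

theorem norm_radial_smul {E : Type*} [NormedAddCommGroup E] [NormedSpace ℝ E]
    {ρ : ℝ → ℝ} (hρ0 : ρ 0 = 0) (x : E) : ‖(ρ ‖x‖ * ‖x‖⁻¹) • x‖ = |ρ ‖x‖| := by
  rcases eq_or_ne x 0 with rfl | hx
  · simp [hρ0]
  · have : ‖x‖ ≠ 0 := norm_ne_zero_iff.2 hx
    rw [norm_smul, norm_mul, norm_inv, norm_norm, Real.norm_eq_abs]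
    field_simp

theorem continuous_radial_smul {E : Type*} [NormedAddCommGroup E] [NormedSpace ℝ E]
    {ρ : ℝ → ℝ} (hρ : Continuous ρ) (hρ0 : ρ 0 = 0) :
    Continuous fun x : E => (ρ ‖x‖ * ‖x‖⁻¹) • x := by
  rw [continuous_iff_continuousAt]
  intro x
  rcases eq_or_ne x 0 with rfl | hx
  · rw [ContinuousAt, smul_zero, tendsto_zero_iff_norm_tendsto_zero]
    simp only [norm_radial_smul hρ0]
    have : Continuous fun x : E => |ρ ‖x‖| := by fun_prop
    simpa [hρ0] using this.tendsto 0
  · exact (((hρ.comp continuous_norm).continuousAt).mul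
      (continuousAt_id.norm.inv₀ (norm_ne_zero_iff.2 hx))).smul continuousAt_id

theorem isWeakGradient_comp_norm {Ω : Set (EuclideanSpace ℝ (Fin N))} (hΩ : IsOpen Ω)
    {W ρ : ℝ → ℝ} (hW : ∀ r, HasDerivAt W (ρ r) r) (hρ : Continuous ρ) (hρ0 : ρ 0 = 0) :
    IsWeakGradient Ω (fun x => W ‖x‖) (fun x => (ρ ‖x‖ * ‖x‖⁻¹) • x) :=
  isWeakGradient_of_hasFDerivAt hΩ (continuous_radial_smul hρ hρ0).continuousOn
    fun x _ => hasFDerivAt_comp_norm hW hρ0 x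

theorem Continuous.memLp_restrict_unitBall {F : Type*} [NormedAddCommGroup F]
    {f : EuclideanSpace ℝ (Fin N) → F} (hf : Continuous f) (p : ℝ≥0∞) :
    MemLp f p (volume.restrict (unitBall N)) := by
  obtain ⟨C, hC⟩ := (isCompact_closedBall (0 : EuclideanSpace ℝ (Fin N)) 1).exists_bound_of_continuousOn
    hf.continuousOn
  have : IsFiniteMeasure (volume.restrict (unitBall N)) := ⟨by simpa using measure_ball_lt_top⟩
  refine MemLp.of_bound hf.aestronglyMeasurable C ?_
  filter_upwards [ae_restrict_mem Metric.isOpen_ball.measurableSet] with x hx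
  exact hC x (Metric.ball_subset_closedBall hx)

theorem continuous_weightedPrimitive {n : ℕ} {f : ℝ → ℝ} (hf : Measurable f) {M : ℝ}
    (hM : ∀ r, |f r| ≤ M) : Continuous (weightedPrimitive n f) := by
  refine intervalIntegral.continuous_primitive (fun a b => ?_) 0
  have hc : IntervalIntegrable (fun s : ℝ => s ^ n) volume a b := by
    apply Continuous.intervalIntegrable; fun_prop
  refine (hc.norm.const_mul M).mono_fun
    ((measurable_id.pow_const _).mul hf).aestronglyMeasurable (Eventually.of_forall fun s => ?_)
  simp only [norm_mul, norm_norm]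
  rw [mul_comm]
  exact mul_le_mul_of_nonneg_right ((hM s).trans (le_abs_self M)) (norm_nonneg _)

theorem continuous_weightedPrimitive_div {n : ℕ} {f : ℝ → ℝ} (hf : Measurable f) {M : ℝ}
    (hM : ∀ r, |f r| ≤ M) : Continuous fun r => weightedPrimitive n f r / r ^ n := by
  rw [continuous_iff_continuousAt]
  intro r
  rcases eq_or_ne r 0 with rfl | hr
  · have h0 : weightedPrimitive n f 0 = 0 := intervalIntegral.integral_same
    rw [ContinuousAt, h0, zero_div]
    refine squeeze_zero_norm (a := fun r => M * |r|) (fun r => ?_) ?_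
    · rw [norm_div, norm_pow]
      refine div_le_of_le_mul₀ (by positivity)
        (mul_nonneg ((abs_nonneg _).trans (hM 0)) (abs_nonneg r)) ?_
      refine (abs_weightedPrimitive_le hM r).trans (le_of_eq ?_)
      rw [Real.norm_eq_abs]; ring
    · have : Continuous fun r : ℝ => M * |r| := by fun_prop
      simpa using this.tendsto 0
  · exact (continuous_weightedPrimitive hf hM).continuousAt.div (by fun_prop) (pow_ne_zero _ hr)

end RadialPrimitive

/-! ### Tools for identifying a solution with its candidate profile. -/

section Identification

variable {N : ℕ} {p q : ℝ}

theorem memSobolev_sub {Ω : Set (EuclideanSpace ℝ (Fin N))}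
    {u v : EuclideanSpace ℝ (Fin N) → ℝ} (hu : MemSobolev p Ω u) (hv : MemSobolev p Ω v) :
    MemSobolev p Ω (fun x => u x - v x) := by
  obtain ⟨F, hF, hFp⟩ := hu.2
  obtain ⟨G, hG, hGp⟩ := hv.2
  exact ⟨hu.1.sub hv.1, _, hF.sub hG, hFp.sub hGp⟩

theorem memSobolev_unitBall_const (c : ℝ) : MemSobolev p (unitBall N) (fun _ => c) :=
  ⟨continuous_const.memLp_restrict_unitBall _, _, isWeakGradient_const Metric.isOpen_ball c,
    continuous_const.memLp_restrict_unitBall _⟩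

theorem memSobolev_comp_norm {W ρ : ℝ → ℝ} (hW : ∀ r, HasDerivAt W (ρ r) r) (hρ : Continuous ρ)
    (hρ0 : ρ 0 = 0) : MemSobolev p (unitBall N) (fun x => W ‖x‖) := by
  have hWc : Continuous W := continuous_iff_continuousAt.2 fun r => (hW r).continuousAt
  exact ⟨(hWc.comp continuous_norm).memLp_restrict_unitBall _, _,
    isWeakGradient_comp_norm Metric.isOpen_ball hW hρ hρ0,
    (continuous_radial_smul hρ hρ0).memLp_restrict_unitBall _⟩

theorem isFiniteMeasure_restrict_unitBall : IsFiniteMeasure (volume.restrict (unitBall N)) :=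
  ⟨by simpa using measure_ball_lt_top⟩

theorem ae_norm_mem_Ioo (hN : 1 ≤ N) :
    ∀ᵐ x ∂volume.restrict (unitBall N), ‖x‖ ∈ Ioo (0 : ℝ) 1 :=
  ae_norm_of_ae hN (ae_restrict_mem measurableSet_Ioo)

theorem setIntegral_unitBall_norm_eq_zero_iff (hN : 1 ≤ N) (f : ℝ → ℝ) :
    ∫ x in unitBall N, f ‖x‖ = 0 ↔ ∫ r in Ioo (0 : ℝ) 1, r ^ (N - 1) * f r = 0 := by
  have c : (N : ℝ) * volume.real (unitBall N) ≠ 0 := by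
    have := volume_real_unitBall_pos (N := N)
    positivity
  rw [setIntegral_unitBall_norm hN, mul_eq_zero, or_iff_right c]

/-- A radial function whose weak gradient vanishes is almost everywhere constant. -/
theorem IsWeakGradient.exists_ae_eq_const_of_radial (hN : 1 ≤ N)
    {u : EuclideanSpace ℝ (Fin N) → ℝ} (hG : IsWeakGradient (unitBall N) u 0)
    {f : ℝ → ℝ} (hf : Measurable f) {A : ℝ} (hA : ∀ r, |f r| ≤ A)
    (hu : ∀ᵐ x ∂volume.restrict (unitBall N), u x = f ‖x‖) :
    ∃ m : ℝ, ∀ᵐ x ∂volume.restrict (unitBall N), u x = m := by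
  have := isFiniteMeasure_restrict_unitBall (N := N)
  have hA0 : 0 ≤ A := (abs_nonneg _).trans (hA 0)
  have hfi : IntegrableOn (fun x : EuclideanSpace ℝ (Fin N) => f ‖x‖) (unitBall N) :=
    Measure.integrableOn_of_bounded (M := A) measure_ball_lt_top.ne
      (hf.comp measurable_norm).aestronglyMeasurable (Eventually.of_forall fun x => hA _)
  have hui : IntegrableOn u (unitBall N) := hfi.congr (hu.mono fun x hx => hx.symm)
  have hV := volume_real_unitBall_pos (N := N)
  set m := (∫ x in unitBall N, f ‖x‖) / volume.real (unitBall N) with hm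
  let k : ℝ → ℝ := fun r => f r - m
  have hk : Measurable k := hf.sub_const m
  have hkb : ∀ r, |k r| ≤ A + |m| := fun r => (abs_sub _ _).trans (add_le_add_left (hA r) _)
  have hk0 : ∫ x in unitBall N, k ‖x‖ = 0 := by
    simp only [k]
    rw [integral_sub hfi (integrable_const m), integral_const, measureReal_restrict_apply_univ,
      hm, smul_eq_mul]
    field_simp
    ring
  -- The divergence theorem with right-hand side `k = f - m`, where `m` is the mean of `f`: a zero
  -- gradient gives `∫ u k = 0`, which becomes `∫ k² = 0`.
  have key := hG.integral_mul_norm hN hui (integrable_zero _ _ _) hk hkb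
    ((setIntegral_unitBall_norm_eq_zero_iff hN k).1 hk0)
  simp only [Pi.zero_apply, inner_zero_right, mul_zero, integral_zero, neg_zero] at key
  have hki : IntegrableOn (fun x : EuclideanSpace ℝ (Fin N) => k ‖x‖) (unitBall N) :=
    hfi.sub (integrable_const m)
  have hk2 : IntegrableOn (fun x : EuclideanSpace ℝ (Fin N) => k ‖x‖ ^ 2) (unitBall N) :=
    Measure.integrableOn_of_bounded (M := (A + |m|) ^ 2) measure_ball_lt_top.ne
      ((hk.comp measurable_norm).pow_const 2).aestronglyMeasurable
      (Eventually.of_forall fun x => by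
        rw [norm_pow]; exact pow_le_pow_left₀ (norm_nonneg _) (hkb _) 2)
  have hsq : ∫ x in unitBall N, k ‖x‖ ^ 2 = 0 := by
    have e : ∫ x in unitBall N, u x * k ‖x‖
        = ∫ x in unitBall N, (k ‖x‖ ^ 2 + m * k ‖x‖) := by
      refine integral_congr_ae ?_
      filter_upwards [hu] with x hx
      simp only [k, hx]; ring
    rw [e, integral_add hk2 (hki.const_mul m), integral_const_mul, hk0, mul_zero, add_zero] at key
    exact key
  rw [integral_eq_zero_iff_of_nonneg (fun x => sq_nonneg _) hk2] at hsq
  refine ⟨m, ?_⟩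
  filter_upwards [hu, hsq] with x hx hx2
  have : k ‖x‖ = 0 := pow_eq_zero_iff two_ne_zero |>.1 hx2
  simp only [k] at this
  linarith

/-- The integrand is nonnegative where `g ≤ 1` and nonpositive where `g ≥ 1`, so for monotone `g` it
changes sign once. If `g` exceeds `1` before `r`, the integral over `[r,1]` is nonpositive and the
total is zero; otherwise the integrand is nonnegative up to `r`. -/
theorem weightedPrimitive_rpow_sub_nonneg {n : ℕ} {g : ℝ → ℝ} (hp1 : 1 < p) (hq : p < q)
    (hg0 : ∀ r, 0 ≤ g r) (hgm : MonotoneOn g (Ioo 0 1)) (hg1 : g 1 = 0) (hgM : Measurable g)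
    {A : ℝ} (hA : ∀ r, |g r ^ (p - 1) - g r ^ (q - 1)| ≤ A)
    (h0 : ∫ r in Ioo (0 : ℝ) 1, r ^ n * (g r ^ (p - 1) - g r ^ (q - 1)) = 0) {r : ℝ}
    (hr0 : 0 ≤ r) (hr1 : r ≤ 1) :
    0 ≤ weightedPrimitive n (fun s => g s ^ (p - 1) - g s ^ (q - 1)) r := by
  have hpos : ∀ s, g s ≤ 1 → 0 ≤ g s ^ (p - 1) - g s ^ (q - 1) := fun s hs => by
    rcases (hg0 s).eq_or_lt with h | h
    · rw [← h, Real.zero_rpow (by linarith), Real.zero_rpow (by linarith), sub_zero]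
    · exact sub_nonneg.2 (Real.rpow_le_rpow_of_exponent_ge h hs (by linarith))
  have hneg : ∀ s, 1 ≤ g s → g s ^ (p - 1) - g s ^ (q - 1) ≤ 0 := fun s hs =>
    sub_nonpos.2 (Real.rpow_le_rpow_of_exponent_le hs (by linarith))
  have hend : g 1 ^ (p - 1) - g 1 ^ (q - 1) = 0 := by
    rw [hg1, Real.zero_rpow (by linarith), Real.zero_rpow (by linarith), sub_zero]
  by_cases hc : ∃ s ∈ Ioo (0 : ℝ) 1, s ≤ r ∧ 1 < g s
  · obtain ⟨s, hs, hsr, hgs⟩ := hc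
    have hm : Measurable fun s => g s ^ (p - 1) - g s ^ (q - 1) :=
      (hgM.pow_const _).sub (hgM.pow_const _)
    have hii := integrableOn_pow_mul_of_bounded hm hA n
    rw [← integrableOn_Ioc_iff_integrableOn_Ioo] at hii
    have i1 : IntervalIntegrable (fun s => s ^ n * (g s ^ (p - 1) - g s ^ (q - 1))) volume 0 r :=
      (intervalIntegrable_iff_integrableOn_Ioc_of_le hr0).2
        (hii.mono_set (Ioc_subset_Ioc_right hr1))
    have i2 : IntervalIntegrable (fun s => s ^ n * (g s ^ (p - 1) - g s ^ (q - 1))) volume r 1 :=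
      (intervalIntegrable_iff_integrableOn_Ioc_of_le hr1).2
        (hii.mono_set (Ioc_subset_Ioc_left hr0))
    have e := intervalIntegral.integral_add_adjacent_intervals i1 i2
    rw [setIntegral_Ioo_eq_intervalIntegral _ zero_le_one |>.symm] at h0
    have : 0 ≤ ∫ t in r..1, -(t ^ n * (g t ^ (p - 1) - g t ^ (q - 1))) := by
      refine intervalIntegral.integral_nonneg hr1 fun t ht => ?_
      rw [← mul_neg]
      refine mul_nonneg (pow_nonneg (hr0.trans ht.1) _) (neg_nonneg.2 ?_)
      rcases ht.2.eq_or_lt with rfl | h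
      · exact hend.le
      · exact hneg t (hgs.le.trans (hgm hs ⟨hs.1.trans_le (hsr.trans ht.1), h⟩ (hsr.trans ht.1)))
    rw [intervalIntegral.integral_neg] at this
    rw [weightedPrimitive]
    linarith
  · push Not at hc
    refine intervalIntegral.integral_nonneg_of_ae_restrict hr0 ?_
    filter_upwards [ae_restrict_mem measurableSet_Icc, ae_restrict_of_ae (compl_mem_ae_iff.2
      (measure_singleton (0 : ℝ)))] with s hs hs0
    refine mul_nonneg (pow_nonneg hs.1 _) ?_
    rcases (hs.2.trans hr1).eq_or_lt with rfl | h
    · exact hend.ge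
    · exact hpos s (hc s ⟨lt_of_le_of_ne hs.1 (fun h => hs0 h.symm), h⟩ hs.2)

end Identification

/-! ### From weak solutions to the radial equation. -/

section Profile

variable {N : ℕ} {p q : ℝ}

/-- Extending the profile monotonically to `ℝ` makes it measurable; cutting it to `(0,1)` gives
bounds on all of `ℝ`. The value `g 1 = 0` is an artefact of the cut and affects only a null set. -/
theorem MemCone.exists_radial_profile (hN : 1 ≤ N) {u : EuclideanSpace ℝ (Fin N) → ℝ}
    (hu : MemCone p u) : ∃ (g : ℝ → ℝ) (A : ℝ), Measurable g ∧ (∀ r, 0 ≤ g r) ∧ (∀ r, g r ≤ A) ∧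
      MonotoneOn g (Ioo 0 1) ∧ g 1 = 0 ∧
      ∀ᵐ x ∂volume.restrict (unitBall N), u x = g ‖x‖ := by
  obtain ⟨-, g, hg0, hgm, hug⟩ := hu
  obtain ⟨f, hf, hfg⟩ := hgm.exists_monotone_extension
    ⟨0, by rintro _ ⟨r, hr, rfl⟩; exact hg0 r hr⟩
    ⟨g 1, by rintro _ ⟨r, hr, rfl⟩; exact hgm hr ⟨one_pos, le_rfl⟩ hr.2⟩
  have hIoo : ∀ r ∈ Ioo (0 : ℝ) 1, (Ioo (0 : ℝ) 1).indicator f r = g r := fun r hr => by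
    rw [indicator_of_mem hr, ← hfg ⟨hr.1, hr.2.le⟩]
  refine ⟨(Ioo 0 1).indicator f, g 1, hf.measurable.indicator measurableSet_Ioo, fun r => ?_,
    fun r => ?_, fun r hr s hs hrs => ?_, by simp, ?_⟩
  · by_cases hr : r ∈ Ioo (0 : ℝ) 1
    · rw [hIoo r hr]; exact hg0 r ⟨hr.1, hr.2.le⟩
    · rw [indicator_of_notMem hr]
  · by_cases hr : r ∈ Ioo (0 : ℝ) 1
    · rw [hIoo r hr]; exact hgm ⟨hr.1, hr.2.le⟩ ⟨one_pos, le_rfl⟩ hr.2.le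
    · rw [indicator_of_notMem hr]; exact hg0 1 ⟨one_pos, le_rfl⟩
  · rw [hIoo r hr, hIoo s hs]; exact hgm ⟨hr.1, hr.2.le⟩ ⟨hs.1, hs.2.le⟩ hrs
  · filter_upwards [hug, ae_norm_mem_Ioo hN] with x hx hx1
    rw [hx, hIoo _ hx1]

theorem MemLp.integrableOn_unitBall {F : Type*} [NormedAddCommGroup F]
    {f : EuclideanSpace ℝ (Fin N) → F} (hp1 : 1 ≤ p)
    (hf : MemLp f (ENNReal.ofReal p) (volume.restrict (unitBall N))) :
    IntegrableOn f (unitBall N) := by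
  have := isFiniteMeasure_restrict_unitBall (N := N)
  exact hf.integrable (by simpa using hp1)

/-- The weak formulation for a solution with profile `g`, with the lower order terms collected. -/
theorem IsConeSolution.integral_flux (hp1 : 1 < p) (hq : p < q)
    {u : EuclideanSpace ℝ (Fin N) → ℝ} (hu : IsConeSolution p q u) {g : ℝ → ℝ} {A : ℝ}
    (hgM : Measurable g) (hg0 : ∀ r, 0 ≤ g r) (hgA : ∀ r, g r ≤ A)
    (hug : ∀ᵐ x ∂volume.restrict (unitBall N), u x = g ‖x‖)
    {φ : EuclideanSpace ℝ (Fin N) → ℝ} (hφ : MemSobolev p (unitBall N) φ) :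
    ∫ x in unitBall N, ‖weakGrad (unitBall N) u x‖ ^ (p - 2) *
        inner ℝ (weakGrad (unitBall N) u x) (weakGrad (unitBall N) φ x)
      = -∫ x in unitBall N, φ x * (g ‖x‖ ^ (p - 1) - g ‖x‖ ^ (q - 1)) := by
  have hφi := MemLp.integrableOn_unitBall hp1.le hφ.1
  have hint : ∀ s : ℝ, 0 ≤ s → IntegrableOn (fun x => φ x * g ‖x‖ ^ s) (unitBall N) := by
    intro s hs
    refine hφi.mul_bdd (c := A ^ s) ((hgM.comp measurable_norm).pow_const s).aestronglyMeasurable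
      (Eventually.of_forall fun x => ?_)
    rw [Real.norm_of_nonneg (Real.rpow_nonneg (hg0 _) _)]
    exact Real.rpow_le_rpow (hg0 _) (hgA _) hs
  have hcongr : ∀ s : ℝ, ∫ x in unitBall N, u x ^ s * φ x
      = ∫ x in unitBall N, φ x * g ‖x‖ ^ s := fun s => by
    refine integral_congr_ae ?_
    filter_upwards [hug] with x hx
    rw [hx, mul_comm]
  have h := hu.2.2 φ hφ
  rw [hcongr, hcongr] at h
  simp only [mul_sub]
  rw [integral_sub (hint _ (by linarith)) (hint _ (by linarith))]
  linarith

theorem setIntegral_weightedPrimitive_congr {n : ℕ} {f g : ℝ → ℝ}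
    (h : ∀ᵐ r ∂volume.restrict (Ioo (0 : ℝ) 1), f r = g r) {r : ℝ} (hr : r ∈ Icc (0 : ℝ) 1) :
    weightedPrimitive n f r = weightedPrimitive n g r := by
  rw [weightedPrimitive, weightedPrimitive, setIntegral_Ioo_eq_intervalIntegral _ hr.1,
    setIntegral_Ioo_eq_intervalIntegral _ hr.1]
  refine integral_congr_ae ?_
  filter_upwards [ae_restrict_of_ae_restrict_of_subset (Ioo_subset_Ioo_right hr.2) h] with s hs
  rw [hs]

/-- A cone solution has a `C^1` radial representative `U` solving the integrated radial equation
`r^{N-1} (U')^{p-1} = ∫_0^r s^{N-1} (U^{p-1} - U^{q-1}) ds`. -/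
theorem IsConeSolution.exists_contDiff_profile (hN : 1 ≤ N) (hp1 : 1 < p) (hq : p < q)
    {u : EuclideanSpace ℝ (Fin N) → ℝ} (hu : IsConeSolution p q u) :
    ∃ U ρ : ℝ → ℝ, (∀ r, HasDerivAt U (ρ r) r) ∧ Continuous ρ ∧ ρ 0 = 0 ∧ (∀ r, 0 ≤ ρ r) ∧
      (∀ r ∈ Icc (0 : ℝ) 1, 0 ≤ U r) ∧
      (∀ r ∈ Icc (0 : ℝ) 1, ρ r ^ (p - 1) * r ^ (N - 1)
        = weightedPrimitive (N - 1) (fun s => U s ^ (p - 1) - U s ^ (q - 1)) r) ∧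
      weightedPrimitive (N - 1) (fun s => U s ^ (p - 1) - U s ^ (q - 1)) 1 = 0 ∧
      ∀ᵐ x ∂volume.restrict (unitBall N), u x = U ‖x‖ := by
  obtain ⟨g, A, hgM, hg0, hgA, hgm, hg1, hug⟩ := hu.1.exists_radial_profile hN
  have hA0 : 0 ≤ A := (hg0 0).trans (hgA 0)
  have hB : IsOpen (unitBall N) := Metric.isOpen_ball
  set k : ℝ → ℝ := fun r => g r ^ (p - 1) - g r ^ (q - 1) with hk
  have hkM : Measurable k := (hgM.pow_const _).sub (hgM.pow_const _)
  have hkb : ∀ r, |k r| ≤ A ^ (p - 1) + A ^ (q - 1) := fun r => by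
    refine (abs_sub _ _).trans (add_le_add ?_ ?_) <;>
      rw [abs_of_nonneg (Real.rpow_nonneg (hg0 _) _)] <;>
      exact Real.rpow_le_rpow (hg0 _) (hgA _) (by linarith)
  -- The constant test function `1`: this encodes the Neumann condition.
  have hk0 : ∫ r in Ioo (0 : ℝ) 1, r ^ (N - 1) * k r = 0 := by
    rw [← setIntegral_unitBall_norm_eq_zero_iff hN]
    have h := hu.integral_flux hp1 hq hgM hg0 hgA hug (memSobolev_unitBall_const 1)
    have e : ∫ x in unitBall N, ‖weakGrad (unitBall N) u x‖ ^ (p - 2) *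
        inner ℝ (weakGrad (unitBall N) u x) (weakGrad (unitBall N) (fun _ => (1 : ℝ)) x) = 0 := by
      refine integral_eq_zero_of_ae ?_
      filter_upwards [(isWeakGradient_const hB 1).weakGrad_ae_eq hB] with x hx
      rw [hx, inner_zero_right, mul_zero, Pi.zero_apply]
    rw [e] at h
    simp only [one_mul] at h
    linarith
  set H := weightedPrimitive (N - 1) k with hH
  have hHnn : ∀ r ∈ Icc (0 : ℝ) 1, 0 ≤ H r := fun r hr =>
    weightedPrimitive_rpow_sub_nonneg hp1 hq hg0 hgm hg1 hgM hkb hk0 hr.1 hr.2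
  have hs0 : 0 < 1 / (p - 1) := by apply one_div_pos.2; linarith
  -- The derivative dictated by the integrated equation. The absolute value makes `ρ` nonnegative
  -- and continuous on all of `ℝ`; on `[0,1]` it is harmless since `H ≥ 0`.
  set ρ : ℝ → ℝ := fun r => |H r / r ^ (N - 1)| ^ (1 / (p - 1)) with hρ
  have hρc : Continuous ρ := (continuous_weightedPrimitive_div hkM hkb).abs.rpow_const
    fun _ => Or.inr hs0.le
  have hH0 : H 0 = 0 := intervalIntegral.integral_same
  have hρ0 : ρ 0 = 0 := by
    simp only [hρ, hH0, zero_div, abs_zero, Real.zero_rpow hs0.ne']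
  have hρnn : ∀ r, 0 ≤ ρ r := fun r => Real.rpow_nonneg (abs_nonneg _) _
  have hρH : ∀ r ∈ Ioc (0 : ℝ) 1, ρ r ^ (p - 1) = H r / r ^ (N - 1) := by
    intro r hr
    simp only [hρ]
    rw [← Real.rpow_mul (abs_nonneg _), one_div_mul_cancel (by linarith), Real.rpow_one,
      abs_of_nonneg (div_nonneg (hHnn r ⟨hr.1.le, hr.2⟩) (pow_nonneg hr.1.le _))]
  set W : ℝ → ℝ := fun r => ∫ s in (0 : ℝ)..r, ρ s with hW
  have hWd : ∀ r, HasDerivAt W (ρ r) r := fun r =>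
    intervalIntegral.integral_hasDerivAt_right (hρc.intervalIntegrable _ _)
      (hρc.stronglyMeasurableAtFilter _ _) hρc.continuousAt
  have hWc : Continuous W := continuous_iff_continuousAt.2 fun r => (hWd r).continuousAt
  set D := weakGrad (unitBall N) u with hD
  let E : EuclideanSpace ℝ (Fin N) → EuclideanSpace ℝ (Fin N) := fun x => (ρ ‖x‖ * ‖x‖⁻¹) • x
  have hDw : IsWeakGradient (unitBall N) u D := hu.1.1.isWeakGradient
  have hDp := hu.1.1.memLp_weakGrad hB
  have hEw : IsWeakGradient (unitBall N) (fun x => W ‖x‖) E :=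
    isWeakGradient_comp_norm hB hWd hρc hρ0
  have hEp : MemLp E (ENNReal.ofReal p) (volume.restrict (unitBall N)) :=
    (continuous_radial_smul hρc hρ0).memLp_restrict_unitBall _
  have hφ : MemSobolev p (unitBall N) (fun x => u x - W ‖x‖) :=
    memSobolev_sub hu.1.1 (memSobolev_comp_norm hWd hρc hρ0)
  have hφw : IsWeakGradient (unitBall N) (fun x => u x - W ‖x‖) (fun x => D x - E x) :=
    hDw.sub hEw
  -- The weak equation for `u` and the divergence theorem for the field with divergence `k` show
  -- that the fluxes of `D` and `E` pair equally with `D - E`; strict monotonicity then applies.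
  have hDE : D =ᵐ[volume.restrict (unitBall N)] E := by
    refine ae_eq_of_integral_flux_inner_sub_eq hp1 hDp hEp ?_
    have h1 := hu.integral_flux hp1 hq hgM hg0 hgA hug hφ
    have h2 := hφw.integral_mul_norm hN (MemLp.integrableOn_unitBall hp1.le hφ.1)
      (MemLp.integrableOn_unitBall hp1.le (hDp.sub hEp)) hkM hkb hk0
    have e1 : ∫ x in unitBall N, ‖D x‖ ^ (p - 2) * inner ℝ (D x) (D x - E x)
        = ∫ x in unitBall N, ‖D x‖ ^ (p - 2) *
          inner ℝ (D x) (weakGrad (unitBall N) (fun x => u x - W ‖x‖) x) := by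
      refine integral_congr_ae ?_
      filter_upwards [hφw.weakGrad_ae_eq hB] with x hx
      rw [hx]
    rw [e1, h1]
    simp only [hk] at h2
    rw [h2, neg_neg]
    refine integral_congr_ae ?_
    filter_upwards [ae_norm_mem_Ioo hN] with x hx
    have hn : ‖E x‖ = ρ ‖x‖ := by
      rw [norm_radial_smul hρ0, abs_of_nonneg (hρnn _)]
    have hxi : inner ℝ (E x) (D x - E x) = ρ ‖x‖ * ‖x‖⁻¹ * inner ℝ x (D x - E x) := by
      simp only [E, real_inner_smul_left]
    rw [hn, hxi, ← mul_assoc, ← mul_assoc, Real.rpow_sub_two_mul_self hp1 (hρnn _),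
      hρH _ ⟨hx.1, hx.2.le⟩]
    have hx0 : ‖x‖ ≠ 0 := hx.1.ne'
    have : ‖x‖ ^ N = ‖x‖ ^ (N - 1) * ‖x‖ := by
      rw [← pow_succ]; congr 1; omega
    rw [this]
    congr 1
    simp only [hH, hk]
    field_simp
  have hφ0 : IsWeakGradient (unitBall N) (fun x => u x - W ‖x‖) 0 := by
    refine ⟨hφw.1, (isWeakGradient_const hB 0).2.1, fun φ h1 h2 h3 i => ?_⟩
    rw [hφw.2.2 φ h1 h2 h3 i]
    congr 1
    refine integral_congr_ae ?_
    filter_upwards [hDE] with x hx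
    simp [hx]
  obtain ⟨C, hC⟩ := (isCompact_Icc (a := (0 : ℝ)) (b := 1)).exists_bound_of_continuousOn
    hWc.continuousOn
  obtain ⟨m, hm⟩ := hφ0.exists_ae_eq_const_of_radial hN
    -- The cut to `(0,1)` supplies the global bound required of the profile.
    (f := (Ioo (0 : ℝ) 1).indicator fun r => g r - W r)
    ((hgM.sub hWc.measurable).indicator measurableSet_Ioo) (A := A + C)
    (fun r => by
      by_cases hr : r ∈ Ioo (0 : ℝ) 1
      · rw [indicator_of_mem hr]
        refine (abs_sub _ _).trans (add_le_add ?_ (hC r ⟨hr.1.le, hr.2.le⟩))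
        rw [abs_of_nonneg (hg0 r)]; exact hgA r
      · rw [indicator_of_notMem hr, abs_zero]
        have := (norm_nonneg _).trans (hC 0 ⟨le_rfl, zero_le_one⟩)
        linarith)
    (by
      filter_upwards [hug, ae_norm_mem_Ioo hN] with x hx hx1
      rw [indicator_of_mem hx1, hx])
  have hUu : ∀ᵐ x ∂volume.restrict (unitBall N), u x = W ‖x‖ + m := by
    filter_upwards [hm] with x hx
    linarith
  have hUg : ∀ᵐ r ∂volume.restrict (Ioo (0 : ℝ) 1), g r = W r + m := by
    refine ae_of_ae_norm hN (measurableSet_eq_fun hgM (hWc.measurable.add_const m)) ?_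
    filter_upwards [hUu, hug] with x hx hx1
    rw [← hx1, hx]
  have hkU : ∀ᵐ r ∂volume.restrict (Ioo (0 : ℝ) 1),
      k r = (W r + m) ^ (p - 1) - (W r + m) ^ (q - 1) := by
    filter_upwards [hUg] with r hr
    simp only [hk, hr]
  have hHU : ∀ r ∈ Icc (0 : ℝ) 1, H r = weightedPrimitive (N - 1)
      (fun s => (W s + m) ^ (p - 1) - (W s + m) ^ (q - 1)) r := fun r hr =>
    setIntegral_weightedPrimitive_congr hkU hr
  refine ⟨fun r => W r + m, ρ, fun r => (hWd r).add_const m, hρc, hρ0, hρnn, ?_, ?_, ?_, hUu⟩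
  · have hae : ∀ᵐ r ∂volume.restrict (Ioo (0 : ℝ) 1), 0 ≤ W r + m := by
      filter_upwards [hUg] with r hr
      rw [← hr]; exact hg0 r
    -- By continuity a negative value would persist on a nonempty open set, of positive measure.
    have hmin : ∀ r ∈ Ioo (0 : ℝ) 1, 0 ≤ W r + m := by
      intro r hr
      by_contra hlt
      rw [not_le] at hlt
      have ho : IsOpen {s : ℝ | W s + m < 0} :=
        isOpen_lt (hWc.add continuous_const) continuous_const
      have hpos : 0 < volume ({s : ℝ | W s + m < 0} ∩ Ioo 0 1) :=
        (ho.inter isOpen_Ioo).measure_pos _ ⟨r, hlt, hr⟩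
      have h0 := ae_iff.1 hae
      rw [Measure.restrict_apply₀' measurableSet_Ioo.nullMeasurableSet] at h0
      simp only [not_le] at h0
      exact hpos.ne' h0
    intro r hr
    have hcl : Icc (0 : ℝ) 1 ⊆ closure {s : ℝ | 0 ≤ W s + m} := by
      rw [← closure_Ioo zero_ne_one]
      exact closure_mono hmin
    exact (isClosed_le continuous_const (hWc.add continuous_const)).closure_subset (hcl hr)
  · intro r hr
    rw [← hHU r hr]
    rcases hr.1.eq_or_lt with rfl | h
    · rw [hρ0, hH0, Real.zero_rpow (by linarith), zero_mul]
    · rw [hρH r ⟨h, hr.2⟩, div_mul_cancel₀ _ (pow_ne_zero _ h.ne')]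
  · rw [← hHU 1 ⟨zero_le_one, le_rfl⟩, hH, weightedPrimitive,
      setIntegral_Ioo_eq_intervalIntegral _ zero_le_one, hk0]

end Profile

/-! ### The Hamiltonian and a priori bounds. -/

section Hamiltonian

variable {p q : ℝ} {n : ℕ} {U ρ : ℝ → ℝ}

theorem monotone_of_hasDerivAt_of_nonneg (hU : ∀ r, HasDerivAt U (ρ r) r) (hρ : ∀ r, 0 ≤ ρ r) :
    Monotone U :=
  monotone_of_deriv_nonneg (fun r => (hU r).differentiableAt) fun r => by
    rw [(hU r).deriv]; exact hρ r

/-- The energy of the radial equation is non-increasing along the radius. -/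
theorem antitoneOn_hamiltonian (hp1 : 1 < p) (hq : p < q) (hU : ∀ r, HasDerivAt U (ρ r) r)
    (hρc : Continuous ρ) (hρ : ∀ r, 0 ≤ ρ r)
    (heq : ∀ r ∈ Icc (0 : ℝ) 1, ρ r ^ (p - 1) * r ^ n
      = weightedPrimitive n (fun s => U s ^ (p - 1) - U s ^ (q - 1)) r) :
    AntitoneOn (fun r => (p - 1) / p * ρ r ^ p + U r ^ q / q - U r ^ p / p) (Icc 0 1) := by
  have hUc : Continuous U := continuous_iff_continuousAt.2 fun r => (hU r).continuousAt
  have hp0 : p ≠ 0 := by linarith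
  have hp10 : p - 1 ≠ 0 := by linarith
  have hq0 : q ≠ 0 := by linarith
  have hκ : Continuous fun s => U s ^ (p - 1) - U s ^ (q - 1) :=
    (hUc.rpow_const fun _ => Or.inr (by linarith)).sub
      (hUc.rpow_const fun _ => Or.inr (by linarith))
  set H := weightedPrimitive n (fun s => U s ^ (p - 1) - U s ^ (q - 1)) with hH
  have hΦ : ∀ r ∈ Ioc (0 : ℝ) 1, ρ r ^ (p - 1) = H r / r ^ n := fun r hr => by
    rw [← heq r ⟨hr.1.le, hr.2⟩, mul_div_cancel_right₀ _ (pow_ne_zero _ hr.1.ne')]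
  have hs1 : 1 ≤ p / (p - 1) := by rw [le_div_iff₀ (by linarith)]; linarith
  -- The power `ρ^p` is differentiated through `H / r^n`, without differentiating `ρ`: the exponent
  -- `p/(p-1)` is at least `1`, so the chain rule holds even where `H = 0`.
  have hρp : ∀ r ∈ Ioc (0 : ℝ) 1, ρ r ^ p = (H r / r ^ n) ^ (p / (p - 1)) := fun r hr => by
    rw [← hΦ r hr, ← Real.rpow_mul (hρ r), mul_div_cancel₀ _ hp10]
  have hder : ∀ r ∈ Ioo (0 : ℝ) 1, HasDerivAt
      (fun r => (p - 1) / p * ρ r ^ p + U r ^ q / q - U r ^ p / p)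
      (-(n / r * ρ r ^ (p - 1) * ρ r)) r := by
    intro r hr
    have hrn : r ^ n ≠ 0 := pow_ne_zero _ hr.1.ne'
    have h1 : HasDerivAt (fun r => H r / r ^ n) _ r :=
      (hasDerivAt_weightedPrimitive (n := n) hκ r).div (hasDerivAt_pow n r) hrn
    have h2 := (h1.rpow_const (p := p / (p - 1)) (Or.inr hs1)).const_mul ((p - 1) / p)
    have h3 := ((hU r).rpow_const (p := q) (Or.inr (by linarith))).div_const q
    have h4 := ((hU r).rpow_const (p := p) (Or.inr hp1.le)).div_const p
    have h5 := (h2.add h3).sub h4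
    refine (h5.congr_of_eventuallyEq ?_).congr_deriv ?_
    · filter_upwards [Ioo_mem_nhds hr.1 hr.2] with s hs
      simp only [Pi.add_apply, Pi.sub_apply, hρp s ⟨hs.1, hs.2.le⟩]
    · have e1 : (H r / r ^ n) ^ (p / (p - 1) - 1) = ρ r := by
        rw [← hΦ r ⟨hr.1, hr.2.le⟩, ← Real.rpow_mul (hρ r), mul_sub, mul_div_cancel₀ _ hp10,
          mul_one, sub_sub_cancel, Real.rpow_one]
      have e2 : weightedPrimitive n (fun s => U s ^ (p - 1) - U s ^ (q - 1)) r
          = ρ r ^ (p - 1) * r ^ n := (heq r ⟨hr.1.le, hr.2.le⟩).symm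
      have e3 : (n : ℝ) * r ^ (n - 1) = n / r * r ^ n := by
        rcases n with _ | n
        · simp
        · have := hr.1.ne'
          simp only [Nat.add_sub_cancel]
          field_simp
          ring
      rw [e1, e2, e3]
      field_simp
      ring
  refine antitoneOn_of_deriv_nonpos (convex_Icc 0 1) ?_ ?_ ?_
  · have : Continuous fun r => (p - 1) / p * ρ r ^ p + U r ^ q / q - U r ^ p / p :=
      ((continuous_const.mul (hρc.rpow_const fun _ => Or.inr (by linarith))).add
        ((hUc.rpow_const fun _ => Or.inr (by linarith)).div_const q)).sub
        ((hUc.rpow_const fun _ => Or.inr (by linarith)).div_const p)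
    exact this.continuousOn
  · rw [interior_Icc]
    exact fun r hr => (hder r hr).differentiableAt.differentiableWithinAt
  · rw [interior_Icc]
    intro r hr
    rw [(hder r hr).deriv, neg_nonpos]
    have := hr.1
    exact mul_nonneg (mul_nonneg (by positivity) (Real.rpow_nonneg (hρ r) _)) (hρ r)

/-- If `U 0 > 1` then `U > 1` throughout, and the integrand of the vanishing integral is strictly
negative. -/
theorem profile_zero_le_one (hp1 : 1 < p) (hq : p < q) (hU : ∀ r, HasDerivAt U (ρ r) r)
    (hρ : ∀ r, 0 ≤ ρ r)
    (h1 : weightedPrimitive n (fun s => U s ^ (p - 1) - U s ^ (q - 1)) 1 = 0) : U 0 ≤ 1 := by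
  have hUc : Continuous U := continuous_iff_continuousAt.2 fun r => (hU r).continuousAt
  by_contra! hlt
  have hc : Continuous fun s : ℝ => -(s ^ n * (U s ^ (p - 1) - U s ^ (q - 1))) :=
    ((continuous_id.pow n).mul ((hUc.rpow_const fun _ => Or.inr (by linarith)).sub
      (hUc.rpow_const fun _ => Or.inr (by linarith)))).neg
  have hpos := intervalIntegral.intervalIntegral_pos_of_pos_on (hc.intervalIntegrable 0 1)
    (fun s hs => ?_) one_pos
  · rw [intervalIntegral.integral_neg] at hpos
    rw [weightedPrimitive] at h1
    linarith
  · have hUs : 1 < U s := hlt.trans_le (monotone_of_hasDerivAt_of_nonneg hU hρ hs.1.le)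
    have := Real.rpow_lt_rpow_of_exponent_lt hUs (by linarith : p - 1 < q - 1)
    rw [← mul_neg]
    exact mul_pos (pow_pos hs.1 n) (by linarith)

/-- A priori bounds for solutions of the radial equation. -/
theorem profile_bounds (hp1 : 1 < p) (hq : p < q) (hU : ∀ r, HasDerivAt U (ρ r) r)
    (hρc : Continuous ρ) (hρ0 : ρ 0 = 0) (hρ : ∀ r, 0 ≤ ρ r) (hU0 : 0 ≤ U 0)
    (heq : ∀ r ∈ Icc (0 : ℝ) 1, ρ r ^ (p - 1) * r ^ n
      = weightedPrimitive n (fun s => U s ^ (p - 1) - U s ^ (q - 1)) r)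
    (h1 : weightedPrimitive n (fun s => U s ^ (p - 1) - U s ^ (q - 1)) 1 = 0) :
    U 1 ≤ (q / p) ^ (1 / (q - p)) ∧
      ∀ r ∈ Icc (0 : ℝ) 1, ρ r ≤ (1 / (p - 1)) ^ (1 / p) * U r := by
  have hm := monotone_of_hasDerivAt_of_nonneg hU hρ
  have hUnn : ∀ r ∈ Icc (0 : ℝ) 1, 0 ≤ U r := fun r hr => hU0.trans (hm hr.1)
  have hp0 : 0 < p := by linarith
  have hq0 : 0 < q := by linarith
  have hE0 : (p - 1) / p * ρ 0 ^ p + U 0 ^ q / q - U 0 ^ p / p ≤ 0 := by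
    rw [hρ0, Real.zero_rpow hp0.ne', mul_zero, zero_add, sub_nonpos]
    have hle : U 0 ^ q ≤ U 0 ^ p := by
      rcases hU0.eq_or_lt with h | h
      · rw [← h, Real.zero_rpow hp0.ne', Real.zero_rpow hq0.ne']
      · exact Real.rpow_le_rpow_of_exponent_ge h (profile_zero_le_one hp1 hq hU hρ h1) hq.le
    exact div_le_div₀ (Real.rpow_nonneg hU0 _) hle hp0 hq.le
  have hE : ∀ r ∈ Icc (0 : ℝ) 1, (p - 1) / p * ρ r ^ p + U r ^ q / q - U r ^ p / p ≤ 0 :=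
    fun r hr => (antitoneOn_hamiltonian hp1 hq hU hρc hρ heq ⟨le_rfl, zero_le_one⟩ hr hr.1).trans hE0
  constructor
  · have h1m : (1 : ℝ) ∈ Icc (0 : ℝ) 1 := ⟨zero_le_one, le_rfl⟩
    rcases (hUnn 1 h1m).eq_or_lt with h | h
    · rw [← h]; positivity
    · have e := hE 1 h1m
      have e1 : 0 ≤ (p - 1) / p * ρ 1 ^ p :=
        mul_nonneg (div_nonneg (by linarith) hp0.le) (Real.rpow_nonneg (hρ 1) _)
      have e2 : U 1 ^ q / q ≤ U 1 ^ p / p := by linarith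
      have hUp : 0 < U 1 ^ p := Real.rpow_pos_of_pos h _
      have e3 : U 1 ^ (q - p) ≤ q / p := by
        rw [Real.rpow_sub h, div_le_div_iff₀ hUp hp0]
        rw [div_le_div_iff₀ hq0 hp0] at e2
        linarith
      rw [one_div]
      exact (Real.le_rpow_inv_iff_of_pos h.le (by positivity) (by linarith)).2 e3
  · intro r hr
    have e := hE r hr
    have e1 : 0 ≤ U r ^ q / q := div_nonneg (Real.rpow_nonneg (hUnn r hr) _) hq0.le
    have e2 : (p - 1) / p * ρ r ^ p ≤ U r ^ p / p := by linarith
    have hp10 : 0 < p - 1 := by linarith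
    have e3 : ρ r ^ p ≤ 1 / (p - 1) * U r ^ p := by
      rw [one_div, inv_mul_eq_div, le_div_iff₀ hp10]
      rw [div_mul_eq_mul_div, div_le_div_iff_of_pos_right hp0] at e2
      linarith
    rw [← Real.rpow_le_rpow_iff (hρ r)
      (mul_nonneg (Real.rpow_nonneg (by positivity) _) (hUnn r hr)) hp0,
      Real.mul_rpow (Real.rpow_nonneg (by positivity) _) (hUnn r hr),
      ← Real.rpow_mul (by positivity), one_div_mul_cancel hp0.ne', Real.rpow_one]
    exact e3

/-- With `t = q/p` the expression is `t ^ (1 / (p t - p))`. -/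
theorem tendsto_profile_bound (hp1 : 1 < p) :
    Tendsto (fun q : ℝ => (q / p) ^ (1 / (q - p))) atTop (𝓝 1) := by
  have hp0 : 0 < p := by linarith
  have h := (tendsto_rpow_div_mul_add 1 p (-p) hp0.ne).comp (tendsto_id.atTop_div_const hp0)
  refine h.congr fun q => ?_
  simp only [Function.comp, id]
  congr 2
  field_simp
  ring

end Hamiltonian

/-! ### Integral identities and quantitative bounds. -/

section Convergence

variable {N : ℕ} {p q : ℝ}

theorem integrableOn_unitBall_comp_norm {f : ℝ → ℝ} (hf : Continuous f) :
    IntegrableOn (fun x : EuclideanSpace ℝ (Fin N) => f ‖x‖) (unitBall N) :=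
  memLp_one_iff_integrable.1 ((hf.comp continuous_norm).memLp_restrict_unitBall 1)

/-- The Nehari identity: the solution is tested against itself. -/
theorem IsConeSolution.integral_norm_weakGrad_rpow (hp1 : 1 < p)
    {u : EuclideanSpace ℝ (Fin N) → ℝ} (hu : IsConeSolution p q u) :
    (∫ x in unitBall N, ‖weakGrad (unitBall N) u x‖ ^ p) + ∫ x in unitBall N, u x ^ p
      = ∫ x in unitBall N, u x ^ q := by
  have h := hu.2.2 u hu.1.1
  simp only [flux_inner_self hp1] at h
  have e : ∀ s : ℝ, ∫ x in unitBall N, u x ^ (s - 1) * u x = ∫ x in unitBall N, u x ^ s :=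
    fun s => by
      refine integral_congr_ae ?_
      filter_upwards [hu.2.1] with x hx
      rw [← Real.rpow_add_one hx.ne']; ring_nf
  rwa [e, e] at h

/-- By the Nehari identity the energy equals `(1/p - 1/q) ∫ u^q`, and this factor is positive. -/
theorem IsConeSolution.lt_integral_rpow (hp1 : 1 < p) (hq : p < q)
    {u : EuclideanSpace ℝ (Fin N) → ℝ} (hu : IsConeSolution p q u)
    (hip : IntegrableOn (fun x => u x ^ p) (unitBall N))
    (hiq : IntegrableOn (fun x => u x ^ q) (unitBall N))
    (he : volume.real (unitBall N) * (1 / p - 1 / q) < energy p q u) :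
    volume.real (unitBall N) < ∫ x in unitBall N, u x ^ q := by
  have hp0 : 0 < p := by linarith
  have hiD : IntegrableOn (fun x => ‖weakGrad (unitBall N) u x‖ ^ p) (unitBall N) := by
    have := integrable_flux_inner hp1 (hu.1.1.memLp_weakGrad Metric.isOpen_ball)
      (hu.1.1.memLp_weakGrad Metric.isOpen_ball)
    simp only [flux_inner_self hp1] at this
    exact this
  have e : energy p q u = (1 / p - 1 / q) * ∫ x in unitBall N, u x ^ q := by
    have e1 : energy p q u = ∫ x in unitBall N,
        (‖weakGrad (unitBall N) u x‖ ^ p / p + u x ^ p / p - u x ^ q / q) := by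
      refine integral_congr_ae ?_
      filter_upwards [hu.2.1] with x hx
      rw [abs_of_pos hx]
    have hadd : IntegrableOn (fun x => ‖weakGrad (unitBall N) u x‖ ^ p / p + u x ^ p / p)
        (unitBall N) := (hiD.div_const p).add (hip.div_const p)
    rw [e1, integral_sub hadd (hiq.div_const q),
      integral_add (hiD.div_const p) (hip.div_const p), integral_div, integral_div, integral_div,
      ← hu.integral_norm_weakGrad_rpow hp1]
    ring
  rw [e, mul_comm] at he
  have : 0 < 1 / p - 1 / q := sub_pos.2 (one_div_lt_one_div_of_lt hp0 hq)
  exact lt_of_mul_lt_mul_left he this.le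

/-- Quantitative bounds for cone solutions whose energy exceeds that of the constant `1`: with
`M = (q/p)^{1/(q-p)}`, they have a continuous radial non-decreasing representative `U ≤ M`, whose
Lipschitz constant, gradient norm and defect from `M` are controlled by `M` and `U(0)`. -/
theorem IsConeSolution.exists_profile_bounds (hN : 1 ≤ N) (hp1 : 1 < p) (hq : p < q)
    {u : EuclideanSpace ℝ (Fin N) → ℝ} (hu : IsConeSolution p q u)
    (he : volume.real (unitBall N) * (1 / p - 1 / q) < energy p q u)
    {M L : ℝ} (hM : M = (q / p) ^ (1 / (q - p))) (hL : L = (1 / (p - 1)) ^ (1 / p)) :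
    ∃ U : ℝ → ℝ, Continuous U ∧ Monotone U ∧ 0 ≤ U 0 ∧ U 0 ≤ 1 ∧ 1 ≤ M ∧ U 1 ≤ M ∧
      (∀ r ∈ Icc (0 : ℝ) 1, ∀ s ∈ Icc (0 : ℝ) 1, |U r - U s| ≤ L * M * |r - s|) ∧
      (∀ᵐ x ∂volume.restrict (unitBall N), u x = U ‖x‖) ∧
      ∫ x in unitBall N, ‖weakGrad (unitBall N) u x‖ ^ p
        ≤ volume.real (unitBall N) * (M ^ p - U 0 ^ p) ∧
      ∀ r ∈ Ioo (0 : ℝ) 1, (M ^ (p - 1) - U r ^ (p - 1)) *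
        volume.real (Metric.ball (0 : EuclideanSpace ℝ (Fin N)) r)
          ≤ volume.real (unitBall N) * (M ^ (p - 1) - 1 / M) := by
  obtain ⟨U, ρ, hUd, hρc, hρ0, hρ, hUnn, heq, h1, huU⟩ := hu.exists_contDiff_profile hN hp1 hq
  have := isFiniteMeasure_restrict_unitBall (N := N)
  have hp0 : 0 < p := by linarith
  have hUc : Continuous U := continuous_iff_continuousAt.2 fun r => (hUd r).continuousAt
  have hm := monotone_of_hasDerivAt_of_nonneg hUd hρ
  have hU0 : 0 ≤ U 0 := hUnn 0 ⟨le_rfl, zero_le_one⟩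
  obtain ⟨hU1, hρU⟩ := profile_bounds hp1 hq hUd hρc hρ0 hρ hU0 heq h1
  rw [← hM] at hU1
  rw [← hL] at hρU
  have hM1 : 1 ≤ M := by
    rw [hM]
    refine Real.one_le_rpow ?_ (one_div_nonneg.2 (by linarith))
    rw [one_le_div hp0]; exact hq.le
  have hM0 : 0 < M := by linarith
  have hL0 : 0 ≤ L := by
    rw [hL]; exact Real.rpow_nonneg (one_div_nonneg.2 (by linarith)) _
  have hUM : ∀ r ∈ Icc (0 : ℝ) 1, U r ≤ M := fun r hr => (hm hr.2).trans hU1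
  have hint : ∀ s : ℝ, 0 ≤ s → IntegrableOn
      (fun x : EuclideanSpace ℝ (Fin N) => U ‖x‖ ^ s) (unitBall N) := fun s hs =>
    integrableOn_unitBall_comp_norm (f := fun r => U r ^ s) (hUc.rpow_const fun _ => Or.inr hs)
  have hpow : ∀ s : ℝ, ∫ x in unitBall N, u x ^ s = ∫ x in unitBall N, U ‖x‖ ^ s := fun s =>
    integral_congr_ae (huU.mono fun x hx => by simp only [hx])
  have hpowi : ∀ s : ℝ, 0 ≤ s → IntegrableOn (fun x => u x ^ s) (unitBall N) := fun s hs =>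
    (hint s hs).congr (huU.mono fun x hx => by simp only [hx])
  have hnorm : ∀ x ∈ unitBall N, ‖x‖ ∈ Icc (0 : ℝ) 1 := fun x hx =>
    ⟨norm_nonneg x, (mem_ball_zero_iff.1 hx).le⟩
  have hlow : volume.real (unitBall N) < ∫ x in unitBall N, U ‖x‖ ^ q := by
    rw [← hpow]
    exact hu.lt_integral_rpow hp1 hq (hpowi p hp0.le) (hpowi q (by linarith)) he
  have hmass : ∫ x in unitBall N, U ‖x‖ ^ (p - 1) = ∫ x in unitBall N, U ‖x‖ ^ (q - 1) := by
    rw [weightedPrimitive, setIntegral_Ioo_eq_intervalIntegral _ zero_le_one,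
      ← setIntegral_unitBall_norm_eq_zero_iff hN (fun s => U s ^ (p - 1) - U s ^ (q - 1)),
      integral_sub (hint _ (by linarith)) (hint _ (by linarith))] at h1
    linarith
  -- One factor of `U^q = U · U^{q-1}` is bounded by `M`; the zero-mean identity then trades `q - 1`
  -- for `p - 1`.
  have hup : ∫ x in unitBall N, U ‖x‖ ^ q ≤ M * ∫ x in unitBall N, U ‖x‖ ^ (p - 1) := by
    rw [hmass, ← integral_const_mul]
    refine setIntegral_mono_on (hint q (by linarith)) ((hint (q - 1) (by linarith)).const_mul M)
      Metric.isOpen_ball.measurableSet fun x hx => ?_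
    have hx' := hnorm x hx
    rw [← Real.rpow_sub_one_mul_self (hp1.trans hq) (hUnn _ hx'), mul_comm]
    exact mul_le_mul_of_nonneg_right (hUM _ hx') (Real.rpow_nonneg (hUnn _ hx') _)
  have hupM : ∀ s : ℝ, 0 ≤ s → ∫ x in unitBall N, U ‖x‖ ^ s ≤ volume.real (unitBall N) * M ^ s := by
    intro s hs
    have : ∫ x in unitBall N, U ‖x‖ ^ s ≤ ∫ x in unitBall N, M ^ s :=
      setIntegral_mono_on (hint s hs) (integrable_const _) Metric.isOpen_ball.measurableSet
        fun x hx => Real.rpow_le_rpow (hUnn _ (hnorm x hx)) (hUM _ (hnorm x hx)) hs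
    rwa [integral_const, measureReal_restrict_apply_univ, smul_eq_mul] at this
  refine ⟨U, hUc, hm, hU0, profile_zero_le_one hp1 hq hUd hρ h1, hM1, hU1, ?_, huU, ?_, ?_⟩
  · intro r hr s hs
    have := Convex.norm_image_sub_le_of_norm_hasDerivWithin_le (f := U) (f' := ρ) (C := L * M)
      (s := Icc (0 : ℝ) 1) (fun x _ => (hUd x).hasDerivWithinAt) (fun x hx => ?_) (convex_Icc 0 1)
      hs hr
    · simpa using this
    · rw [Real.norm_of_nonneg (hρ x)]
      exact (hρU x hx).trans (mul_le_mul_of_nonneg_left (hUM x hx) hL0)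
  · have h := hu.integral_norm_weakGrad_rpow hp1
    rw [hpow, hpow] at h
    have h2 : volume.real (unitBall N) * U 0 ^ p ≤ ∫ x in unitBall N, U ‖x‖ ^ p := by
      have : ∫ x in unitBall N, U 0 ^ p ≤ ∫ x in unitBall N, U ‖x‖ ^ p :=
        setIntegral_mono_on (integrable_const _) (hint p hp0.le) Metric.isOpen_ball.measurableSet
          fun x _ => Real.rpow_le_rpow hU0 (hm (norm_nonneg x)) hp0.le
      rwa [integral_const, measureReal_restrict_apply_univ, smul_eq_mul] at this
    have h3 : M * ∫ x in unitBall N, U ‖x‖ ^ (p - 1) ≤ volume.real (unitBall N) * M ^ p := by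
      have := mul_le_mul_of_nonneg_left (hupM (p - 1) (by linarith)) hM0.le
      rw [← Real.rpow_sub_one_mul_self hp1 hM0.le]
      linarith
    rw [mul_sub]
    linarith
  · intro r hr
    have hsub : Metric.ball (0 : EuclideanSpace ℝ (Fin N)) r ⊆ unitBall N :=
      Metric.ball_subset_ball hr.2.le
    have hdi : IntegrableOn (fun x : EuclideanSpace ℝ (Fin N) => M ^ (p - 1) - U ‖x‖ ^ (p - 1))
        (unitBall N) := (integrable_const _).sub (hint _ (by linarith))
    have hmono : ∫ x in Metric.ball (0 : EuclideanSpace ℝ (Fin N)) r,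
        (M ^ (p - 1) - U ‖x‖ ^ (p - 1)) ≤ ∫ x in unitBall N, (M ^ (p - 1) - U ‖x‖ ^ (p - 1)) := by
      refine setIntegral_mono_set hdi ?_ hsub.eventuallyLE
      filter_upwards [ae_restrict_mem Metric.isOpen_ball.measurableSet] with x hx
      exact sub_nonneg.2 (Real.rpow_le_rpow (hUnn _ (hnorm x hx)) (hUM _ (hnorm x hx))
        (by linarith))
    have hball : (M ^ (p - 1) - U r ^ (p - 1)) *
        volume.real (Metric.ball (0 : EuclideanSpace ℝ (Fin N)) r)
        ≤ ∫ x in Metric.ball (0 : EuclideanSpace ℝ (Fin N)) r,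
          (M ^ (p - 1) - U ‖x‖ ^ (p - 1)) := by
      have hc : IntegrableOn (fun _ : EuclideanSpace ℝ (Fin N) => M ^ (p - 1) - U r ^ (p - 1))
        (Metric.ball (0 : EuclideanSpace ℝ (Fin N)) r) := integrableOn_const measure_ball_lt_top.ne
      have : ∫ x in Metric.ball (0 : EuclideanSpace ℝ (Fin N)) r,
          (M ^ (p - 1) - U r ^ (p - 1)) ≤ ∫ x in Metric.ball (0 : EuclideanSpace ℝ (Fin N)) r,
          (M ^ (p - 1) - U ‖x‖ ^ (p - 1)) :=
        setIntegral_mono_on hc (hdi.mono_set hsub) Metric.isOpen_ball.measurableSet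
          fun x hx => sub_le_sub_left (Real.rpow_le_rpow (hUnn _ (hnorm x (hsub hx)))
            (hm (mem_ball_zero_iff.1 hx).le) (by linarith)) _
      rwa [integral_const, measureReal_restrict_apply_univ, smul_eq_mul, mul_comm] at this
    have hfull : ∫ x in unitBall N, (M ^ (p - 1) - U ‖x‖ ^ (p - 1))
        ≤ volume.real (unitBall N) * (M ^ (p - 1) - 1 / M) := by
      rw [integral_sub (integrable_const _) (hint _ (by linarith)), integral_const,
        measureReal_restrict_apply_univ, smul_eq_mul, mul_sub, mul_one_div]
      -- This is where the energy hypothesis enters: `|B| < ∫ U^q ≤ M ∫ U^{p-1}`.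
      have : volume.real (unitBall N) / M ≤ ∫ x in unitBall N, U ‖x‖ ^ (p - 1) := by
        rw [div_le_iff₀ hM0]
        linarith
      linarith
    exact hball.trans (hmono.trans hfull)

end Convergence

/-! ### Norm estimates and the limit. -/

section MainTheorem

variable {N : ℕ} {p : ℝ}

theorem sobolevNorm_sub_one_le (hp1 : 1 < p) {u : EuclideanSpace ℝ (Fin N) → ℝ}
    (hu : MemSobolev p (unitBall N) u) {Δ K : ℝ}
    (hΔ : ∀ᵐ x ∂volume.restrict (unitBall N), |u x - 1| ≤ Δ)
    (hK : ∫ x in unitBall N, ‖weakGrad (unitBall N) u x‖ ^ p ≤ K) :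
    sobolevNorm p (unitBall N) (fun x => u x - 1)
      ≤ ENNReal.ofReal (K + volume.real (unitBall N) * Δ ^ p) ^ (1 / p) := by
  have := isFiniteMeasure_restrict_unitBall (N := N)
  have hp0 : 0 < p := by linarith
  have hB : IsOpen (unitBall N) := Metric.isOpen_ball
  have hiD : IntegrableOn (fun x => ‖weakGrad (unitBall N) u x‖ ^ p) (unitBall N) := by
    have := integrable_flux_inner hp1 (hu.memLp_weakGrad hB) (hu.memLp_weakGrad hB)
    simp only [flux_inner_self hp1] at this
    exact this
  have hG := (hu.isWeakGradient.sub (isWeakGradient_const hB 1)).weakGrad_ae_eq hB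
  refine ENNReal.rpow_le_rpow ?_ (by positivity)
  calc ∫⁻ x in unitBall N, (‖weakGrad (unitBall N) (fun x => u x - 1) x‖ₑ ^ p + ‖u x - 1‖ₑ ^ p)
      ≤ ∫⁻ x in unitBall N, ENNReal.ofReal (‖weakGrad (unitBall N) u x‖ ^ p + Δ ^ p) := by
        refine lintegral_mono_ae ?_
        filter_upwards [hG, hΔ] with x hx hx2
        rw [hx, sub_zero, ENNReal.ofReal_add (by positivity)
          (Real.rpow_nonneg ((abs_nonneg _).trans hx2) _),
          ← ENNReal.ofReal_rpow_of_nonneg (norm_nonneg _) hp0.le,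
          ← ENNReal.ofReal_rpow_of_nonneg ((abs_nonneg _).trans hx2) hp0.le, ofReal_norm]
        refine add_le_add_right (ENNReal.rpow_le_rpow ?_ hp0.le) _
        rw [← ofReal_norm]
        exact ENNReal.ofReal_le_ofReal hx2
    _ = ENNReal.ofReal (∫ x in unitBall N, (‖weakGrad (unitBall N) u x‖ ^ p + Δ ^ p)) := by
        refine (ofReal_integral_eq_lintegral_ofReal (hiD.add (integrable_const _)) ?_).symm
        filter_upwards [hΔ] with x hx
        exact add_nonneg (by positivity) (Real.rpow_nonneg ((abs_nonneg _).trans hx) _)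
    _ ≤ _ := by
        refine ENNReal.ofReal_le_ofReal ?_
        rw [integral_add hiD (integrable_const _), integral_const, measureReal_restrict_apply_univ,
          smul_eq_mul]
        linarith

/-- Interpolation: an increment is split into its powers `ν` and `1 - ν`, bounded by the Lipschitz
constant and by the oscillation respectively. -/
theorem holderNormOn_comp_norm_sub_one_le {U : ℝ → ℝ} {C Δ : ℝ} (hC : 0 ≤ C) (hΔ : 0 ≤ Δ)
    (hLip : ∀ r ∈ Icc (0 : ℝ) 1, ∀ s ∈ Icc (0 : ℝ) 1, |U r - U s| ≤ C * |r - s|)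
    (hosc : ∀ r ∈ Icc (0 : ℝ) 1, ∀ s ∈ Icc (0 : ℝ) 1, |U r - U s| ≤ Δ)
    (hsup : ∀ r ∈ Icc (0 : ℝ) 1, |U r - 1| ≤ Δ) {ν : ℝ≥0} (hν : ν < 1) :
    holderNormOn ν (Metric.closedBall (0 : EuclideanSpace ℝ (Fin N)) 1) (fun x => U ‖x‖ - 1)
      ≤ ENNReal.ofReal Δ + ENNReal.ofReal (C ^ (ν : ℝ) * Δ ^ (1 - (ν : ℝ))) := by
  have hν1 : 0 ≤ 1 - (ν : ℝ) := sub_nonneg.2 (by exact_mod_cast hν.le)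
  have hmem : ∀ x ∈ Metric.closedBall (0 : EuclideanSpace ℝ (Fin N)) 1, ‖x‖ ∈ Icc (0 : ℝ) 1 :=
    fun x hx => ⟨norm_nonneg x, mem_closedBall_zero_iff.1 hx⟩
  refine add_le_add (iSup₂_le fun x hx => ?_) ?_
  · rw [← ofReal_norm]
    exact ENNReal.ofReal_le_ofReal (hsup _ (hmem x hx))
  · refine HolderWith.eHolderNorm_le (C := Real.toNNReal (C ^ (ν : ℝ) * Δ ^ (1 - (ν : ℝ)))) ?_
    rintro ⟨x, hx⟩ ⟨y, hy⟩
    rw [edist_dist, edist_dist, ENNReal.ofReal_rpow_of_nonneg dist_nonneg ν.coe_nonneg,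
      ← ENNReal.ofReal, ← ENNReal.ofReal_mul (by positivity)]
    refine ENNReal.ofReal_le_ofReal ?_
    have e : dist ((Metric.closedBall (0 : EuclideanSpace ℝ (Fin N)) 1).domRestrict
        (fun x => U ‖x‖ - 1) ⟨x, hx⟩) ((Metric.closedBall (0 : EuclideanSpace ℝ (Fin N)) 1).domRestrict
        (fun x => U ‖x‖ - 1) ⟨y, hy⟩) = |U ‖x‖ - U ‖y‖| := by
      rw [Real.dist_eq]
      simp
    rw [e, Subtype.dist_eq, dist_eq_norm]
    have h1 : |U ‖x‖ - U ‖y‖| ≤ C * ‖x - y‖ :=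
      (hLip _ (hmem x hx) _ (hmem y hy)).trans
        (mul_le_mul_of_nonneg_left (abs_norm_sub_norm_le x y) hC)
    have h2 := hosc _ (hmem x hx) _ (hmem y hy)
    have ha := abs_nonneg (U ‖x‖ - U ‖y‖)
    calc |U ‖x‖ - U ‖y‖| = |U ‖x‖ - U ‖y‖| ^ (ν : ℝ) * |U ‖x‖ - U ‖y‖| ^ (1 - (ν : ℝ)) := by
          rw [← Real.rpow_add' ha (by simp), add_sub_cancel, Real.rpow_one]
      _ ≤ (C * ‖x - y‖) ^ (ν : ℝ) * Δ ^ (1 - (ν : ℝ)) :=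
          mul_le_mul (Real.rpow_le_rpow ha h1 ν.coe_nonneg) (Real.rpow_le_rpow ha h2 hν1)
            (Real.rpow_nonneg ha _) (by positivity)
      _ = C ^ (ν : ℝ) * Δ ^ (1 - (ν : ℝ)) * ‖x - y‖ ^ (ν : ℝ) := by
          rw [Real.mul_rpow hC (norm_nonneg _)]; ring

/-- A non-decreasing Lipschitz function whose mass on small balls is asymptotically full has its
minimum converging to `1`. -/
theorem tendsto_profile_zero (hp1 : 1 < p) {l : Filter ℝ} {M m : ℝ → ℝ} {L : ℝ} (hL : 0 ≤ L)
    (hM : Tendsto M l (𝓝 1)) (hm0 : ∀ᶠ q in l, 0 ≤ m q) (hm1 : ∀ᶠ q in l, m q ≤ 1)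
    (h : ∀ r ∈ Ioo (0 : ℝ) 1, ∀ᶠ q in l, (M q ^ (p - 1) - (m q + L * M q * r) ^ (p - 1)) *
        volume.real (Metric.ball (0 : EuclideanSpace ℝ (Fin N)) r)
          ≤ volume.real (unitBall N) * (M q ^ (p - 1) - 1 / M q)) :
    Tendsto m l (𝓝 1) := by
  refine tendsto_order.2 ⟨fun a ha => ?_, fun a ha => hm1.mono fun q hq => hq.trans_lt ha⟩
  obtain ⟨b, hb, hb1⟩ : ∃ b, max a 0 < b ∧ b < 1 := exists_between (max_lt ha one_pos)
  have hab : a < b := (le_max_left _ _).trans_lt hb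
  have hb0 : 0 < b := (le_max_right _ _).trans_lt hb
  -- Once `M < 2`, a minimum `m ≤ a` would keep `m + L M r` below `b < 1`. The mass inequality then
  -- fails: its left side stays above a quantity with positive limit, while its right side tends to
  -- `0`. The `+ 1` in `2 * L + 1` avoids dividing by zero.
  obtain ⟨r, hr0, hr1, hr2⟩ : ∃ r : ℝ, 0 < r ∧ r < 1 ∧ L * 2 * r ≤ b - a := by
    have hd : 0 < 2 * L + 1 := by linarith
    refine ⟨min (1 / 2) ((b - a) / (2 * L + 1)), lt_min (by norm_num)
      (div_pos (by linarith) hd), (min_le_left _ _).trans_lt (by norm_num), ?_⟩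
    have h1 := min_le_right (1 / 2) ((b - a) / (2 * L + 1))
    rw [le_div_iff₀ hd] at h1
    have h2 : 0 ≤ min (1 / 2) ((b - a) / (2 * L + 1)) :=
      le_min (by norm_num) (div_nonneg (by linarith) hd.le)
    linarith
  have hvr : 0 < volume.real (Metric.ball (0 : EuclideanSpace ℝ (Fin N)) r) :=
    ENNReal.toReal_pos (Metric.measure_ball_pos _ _ hr0).ne' measure_ball_lt_top.ne
  have hMp : Tendsto (fun q => M q ^ (p - 1)) l (𝓝 1) := by
    simpa using hM.rpow_const (p := p - 1) (Or.inl one_ne_zero)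
  have hlim1 : Tendsto (fun q => (M q ^ (p - 1) - b ^ (p - 1)) *
      volume.real (Metric.ball (0 : EuclideanSpace ℝ (Fin N)) r)) l
      (𝓝 ((1 - b ^ (p - 1)) * volume.real (Metric.ball (0 : EuclideanSpace ℝ (Fin N)) r))) :=
    (hMp.sub_const _).mul_const _
  have hlim2 : Tendsto (fun q => volume.real (unitBall N) * (M q ^ (p - 1) - 1 / M q)) l (𝓝 0) := by
    have := (hMp.sub (hM.inv₀ one_ne_zero)).const_mul (volume.real (unitBall N))
    simpa using this
  have hgap : 0 < (1 - b ^ (p - 1)) *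
      volume.real (Metric.ball (0 : EuclideanSpace ℝ (Fin N)) r) :=
    mul_pos (sub_pos.2 (Real.rpow_lt_one hb0.le hb1 (by linarith))) hvr
  filter_upwards [hlim2.eventually_lt hlim1 hgap, h r ⟨hr0, hr1⟩, hm0,
    hM.eventually (gt_mem_nhds one_lt_two), hM.eventually (lt_mem_nhds one_pos)]
    with q h1 h2 h3 h4 h5
  by_contra! hle
  have h6 : m q + L * M q * r ≤ b := by
    have : L * M q * r ≤ L * 2 * r :=
      mul_le_mul_of_nonneg_right (mul_le_mul_of_nonneg_left h4.le hL) hr0.le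
    linarith
  have h7 : (m q + L * M q * r) ^ (p - 1) ≤ b ^ (p - 1) :=
    Real.rpow_le_rpow (by positivity) h6 (by linarith)
  have h8 := mul_le_mul_of_nonneg_right (sub_le_sub_left h7 (M q ^ (p - 1))) hvr.le
  linarith

end MainTheorem

theorem theorem1p1 (N : ℕ) (hN : 1 ≤ N) (p : ℝ) (hp1 : 1 < p) (hp2 : p < 2)
    (S : Set ℝ) (hS : ∀ q ∈ S, p < q)
    (v : ℝ → EuclideanSpace ℝ (Fin N) → ℝ)
    (hsol : ∀ q ∈ S, IsConeSolution p q (v q))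
    (henergy : ∀ q ∈ S, volume.real (unitBall N) * (1 / p - 1 / q) < energy p q (v q)) :
    Tendsto (fun q => sobolevNorm p (unitBall N) (fun x => v q x - 1)) (atTop ⊓ 𝓟 S) (𝓝 0) ∧
      ∃ w : ℝ → EuclideanSpace ℝ (Fin N) → ℝ,
        (∀ q ∈ S, ContinuousOn (w q) (Metric.closedBall 0 1) ∧
          w q =ᵐ[volume.restrict (unitBall N)] v q) ∧
        ∀ ν : ℝ≥0, 0 < ν → ν < 1 →
          Tendsto (fun q => holderNormOn ν (Metric.closedBall 0 1) (fun x => w q x - 1))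
            (atTop ⊓ 𝓟 S) (𝓝 0) := by
  have hp0 : 0 < p := by linarith
  set M : ℝ → ℝ := fun q => (q / p) ^ (1 / (q - p)) with hM
  set L : ℝ := (1 / (p - 1)) ^ (1 / p) with hL
  have hL0 : 0 ≤ L := Real.rpow_nonneg (one_div_nonneg.2 (by linarith)) _
  set l : Filter ℝ := atTop ⊓ 𝓟 S
  have hSl : ∀ᶠ q in l, q ∈ S := mem_inf_of_right (mem_principal_self S)
  have hex := fun (q : ℝ) (hq : q ∈ S) => (hsol q hq).exists_profile_bounds hN hp1 (hS q hq)
    (henergy q hq) (M := M q) (L := L) rfl rfl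
  have hex' : ∀ q : ℝ, ∃ U : ℝ → ℝ, q ∈ S → _ := fun q => by
    by_cases hq : q ∈ S
    · obtain ⟨U, hU⟩ := hex q hq
      exact ⟨U, fun _ => hU⟩
    · exact ⟨0, fun h => absurd h hq⟩
  choose U hU using hex'
  have hMl : Tendsto M l (𝓝 1) := (tendsto_profile_bound hp1).mono_left inf_le_left
  have hml : Tendsto (fun q => U q 0) l (𝓝 1) := by
    refine tendsto_profile_zero (N := N) hp1 hL0 hMl (hSl.mono fun q hq => (hU q hq).2.2.1)
      (hSl.mono fun q hq => (hU q hq).2.2.2.1) fun r hr => ?_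
    filter_upwards [hSl] with q hq
    obtain ⟨-, hmono, h0, -, hM1, -, hLip, -, -, hr'⟩ := hU q hq
    refine le_trans (mul_le_mul_of_nonneg_right (sub_le_sub_left (Real.rpow_le_rpow
      (h0.trans (hmono hr.1.le)) ?_ (by linarith)) _) measureReal_nonneg) (hr' r hr)
    have h1 := hLip r ⟨hr.1.le, hr.2.le⟩ 0 ⟨le_rfl, zero_le_one⟩
    rw [sub_zero, abs_of_pos hr.1] at h1
    linarith [le_abs_self (U q r - U q 0)]
  -- As `U 0 ≤ 1 ≤ M`, this one quantity bounds both the oscillation of `U` and its distance from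
  -- `1` on `[0,1]`.
  have hΔl : Tendsto (fun q => M q - U q 0) l (𝓝 0) := by simpa using hMl.sub hml
  have hclose : ∀ q ∈ S, ∀ r ∈ Icc (0 : ℝ) 1, |U q r - 1| ≤ M q - U q 0 := by
    intro q hq r hr
    obtain ⟨-, hmono, h0, h1, hM1, hUM, -⟩ := hU q hq
    have e1 := hmono hr.1
    have e2 := (hmono hr.2).trans hUM
    rw [abs_le]
    constructor <;> linarith
  refine ⟨?_, fun q x => U q ‖x‖, fun q hq => ?_, fun ν hν0 hν1 => ?_⟩
  · have hlim : Tendsto (fun q => ENNReal.ofReal (volume.real (unitBall N) *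
        (M q ^ p - U q 0 ^ p) + volume.real (unitBall N) * (M q - U q 0) ^ p) ^ (1 / p)) l
        (𝓝 0) := by
      have h1 := ((hMl.rpow_const (p := p) (Or.inl one_ne_zero)).sub
        (hml.rpow_const (p := p) (Or.inl one_ne_zero))).const_mul (volume.real (unitBall N))
      have h2 := (hΔl.rpow_const (p := p) (Or.inr hp0.le)).const_mul (volume.real (unitBall N))
      have h3 := (ENNReal.tendsto_ofReal (h1.add h2)).ennrpow_const (1 / p)
      simpa [Real.zero_rpow hp0.ne', ENNReal.zero_rpow_of_pos, hp0] using h3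
    refine tendsto_of_tendsto_of_tendsto_of_le_of_le' tendsto_const_nhds hlim
      (Eventually.of_forall fun _ => zero_le) ?_
    filter_upwards [hSl] with q hq
    obtain ⟨-, -, -, -, -, -, -, hvU, hD, -⟩ := hU q hq
    refine sobolevNorm_sub_one_le hp1 (hsol q hq).1.1 ?_ hD
    filter_upwards [hvU, ae_norm_mem_Ioo hN] with x hx hx1
    rw [hx]
    exact hclose q hq _ ⟨hx1.1.le, hx1.2.le⟩
  · obtain ⟨hc, -, -, -, -, -, -, hvU, -, -⟩ := hU q hq
    exact ⟨(hc.comp continuous_norm).continuousOn, hvU.mono fun x hx => hx.symm⟩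
  · have hν1' : 0 < 1 - (ν : ℝ) := sub_pos.2 (by exact_mod_cast hν1)
    have hlim : Tendsto (fun q => ENNReal.ofReal (M q - U q 0) +
        ENNReal.ofReal ((L * M q) ^ (ν : ℝ) * (M q - U q 0) ^ (1 - (ν : ℝ)))) l (𝓝 0) := by
      have h1 := ENNReal.tendsto_ofReal hΔl
      have h2 := ENNReal.tendsto_ofReal (((hMl.const_mul L).rpow_const (p := (ν : ℝ))
        (Or.inr ν.coe_nonneg)).mul (hΔl.rpow_const (p := 1 - (ν : ℝ)) (Or.inr hν1'.le)))
      simpa [Real.zero_rpow hν1'.ne'] using h1.add h2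
    refine tendsto_of_tendsto_of_tendsto_of_le_of_le' tendsto_const_nhds hlim
      (Eventually.of_forall fun _ => zero_le) ?_
    filter_upwards [hSl] with q hq
    obtain ⟨-, hmono, h0, h1, hM1, hUM, hLip, -⟩ := hU q hq
    refine holderNormOn_comp_norm_sub_one_le (by positivity) (by linarith) hLip
      (fun r hr s hs => ?_) (hclose q hq) hν1
    have e1 := hmono hr.1
    have e2 := (hmono hr.2).trans hUM
    have e3 := hmono hs.1
    have e4 := (hmono hs.2).trans hUM
    rw [abs_le]
    constructor <;> linarith
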